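/- Let $\mathbb K$ be a field with $\operatorname{char}\mathbb K\neq 2$, let $V$ be a $\mathbb K$-vector space with basis $v_1,\dots,v_n$, let $\mathbf q=(q_{ij})_{1\le i,j\le n}$ be nonzero elements of $\mathbb K$, and let $G\subset GL(V)$ be a finite group with $\operatorname{char}\mathbb K\nmid |G|$. Let $$\Lambda_{\mathbf q}(V)=\mathbb K\langle v_1,\dots,v_n\mid v_jv_i=q_{ij}v_iv_j \text{ and } v_i^2=0 \text{ for } i\neq j\rangle .$$ If $G$ acts by algebra automorphisms on an algebra $A$, then $A\rtimes G$ is the skew group algebra, with product $(ag)(bh)=a({}^g b)\,gh$. For a bilinear map $\kappa:V\times V\to\mathbb KG$ put $$\hat{\mathcal H}_{\mathbf q,\kappa,t}=(T(V)\rtimes G)[t]\big/\big(v_jv_i-q_{ij}v_iv_j-\kappa(v_i,v_j)t,\ v_i^2 \;:\; 1\le i,j\le n\big).$$ This algebra is called a truncated quantum Drinfeld Hecke algebra over $\mathbb K[t]$ if the elements $v_1^{\alpha_1}\cdots v_n^{\alpha_n}g$ with $\alpha_i\in\{0,1\}$, $g\in G$ form a basis of it over $\mathbb K[t]$ (a PBW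 basis). A deformation over $\mathbb K[t]$ of a $\mathbb K$-algebra $A$ is an associative $\mathbb K[t]$-bilinear product $*$ on $A[t]$ such that, for all $a,b\in A$, $$a*b=ab+\mu_1(a,b)t+\mu_2(a,b)t^2+\cdots\quad\text{(a finite sum)},$$ with $\mu_i:A\times A\to A$ bilinear. Grade $\Lambda_{\mathbf q}(V)\rtimes G$ by $\deg v_i=1$ and $\deg g=0$ for $g\in G$; $\deg\mu_i=-2i$ means that $\mu_i(a,b)$ is homogeneous of degree $p+r-2i$ (in particular zero if $p+r-2i<0$) whenever $a,b$ are homogeneous of degrees $p,r$. **Theorem.** The truncated quantum Drinfeld Hecke algebras over $\mathbb K[t]$ are exactly the deformations of $\Lambda_{\mathbf q}(V)\rtimes G$ over $\mathbb K[t]$ with $\deg\mu_i=-2i$ and $\mu_i(v_j,v_j)=0$ for all $j\in\{1,\dots,n\}$ and all $i>0$. That is: 1. If $\hat{\mathcal H}_{\mathbf q,\kappa,t}$ is a truncated quantum Drinfeld Hecke algebra over $\mathbb K[t]$, then $q_{ij}q_{ji}=1$ for all $i\ne j$, the action of $G$ on $V$ extends to an action on $\Lambda_{\mathbf q}(V)$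 by algebra automorphisms, and there is a deformation $D$ of $\Lambda_{\mathbf q}(V)\rtimes G$ over $\mathbb K[t]$ with $\deg\mu_i=-2i$ and $\mu_i(v_j,v_j)=0$ for all $j$ and all $i>0$, together with an isomorphism of $\mathbb K[t]$-algebras $\hat{\mathcal H}_{\mathbf q,\kappa,t}\cong D$ sending $v_i\mapsto v_i$ and $g\mapsto g$ for all $i$ and all $g\in G$. 2. Conversely, suppose that $q_{ij}q_{ji}=1$ for all $i\neq j$ and that the action of $G$ on $V$ extends to an action on $\Lambda_{\mathbf q}(V)$ by algebra automorphisms. For every deformation $D$ of $\Lambda_{\mathbf q}(V)\rtimes G$ over $\mathbb K[t]$ with $\deg\mu_i=-2i$ and $\mu_i(v_j,v_j)=0$ for all $j$ and all $i>0$ there is a bilinear map $\kappa:V\times V\to\mathbb KG$ such that $\hat{\mathcal H}_{\mathbf q,\kappa,t}$ is a truncated quantum Drinfeld Hecke algebra over $\mathbb K[t]$, together with an isomorphism of $\mathbb K[t]$-algebras $\hat{\mathcal H}_{\mathbf q,\kappa,t}\cong D$ sending $v_i\mapsto v_i$ and $g\mapsto g$ for all $i$ and all $g\in G$. -/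

import Mathlib

open Polynomial

noncomputable section

/-! ### Skew group algebras -/

section SkewGroupAlgebra

variable {K : Type*} [Field K] {A : Type*} [Ring A] [Algebra K A] {G : Type*} [Group G]

/-- The action of `G` on `A` by ring automorphisms given by `ρ : G →* Aut_K(A)`. -/
@[reducible]
def actionOf (ρ : G →* (A ≃ₐ[K] A)) : MulSemiringAction G A :=
  MulSemiringAction.compHom A ρ

/-- Mathlib's `K`-algebra structure on `SkewMonoidAlgebra A G`. -/
@[reducible]
def skewMonoidAlgebraAlgebra (K : Type*) [Field K] (A : Type*) [Ring A] [Algebra K A] (G : Type*)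
    [Group G] [MulSemiringAction G A] [SMulCommClass G K A] : Algebra K (SkewMonoidAlgebra A G) :=
  inferInstance

/-- The skew group algebra `A ⋊ G` for an action `ρ` of `G` on the `K`-algebra `A`: its elements
are the finite sums `∑ a_g g`, multiplied by `(a g) (b h) = a (ρ g b) (g h)`. -/
@[nolint unusedArguments]
def SkewGroupAlgebra (_ρ : G →* (A ≃ₐ[K] A)) : Type _ :=
  SkewMonoidAlgebra A G

variable (ρ : G →* (A ≃ₐ[K] A))

instance SkewGroupAlgebra.instRing : Ring (SkewGroupAlgebra ρ) :=
  @SkewMonoidAlgebra.instRing A G _ _ (actionOf ρ)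

instance SkewGroupAlgebra.instAlgebra : Algebra K (SkewGroupAlgebra ρ) :=
  @skewMonoidAlgebraAlgebra K _ A _ _ G _ (actionOf ρ)
    (letI := actionOf ρ; ⟨fun g c a => map_smul (ρ g) c a⟩)

/-- The element `a g` of `A ⋊ G`. -/
def SkewGroupAlgebra.mon (a : A) (g : G) : SkewGroupAlgebra ρ :=
  SkewMonoidAlgebra.single g a

/-- The defining multiplication rule `(a g) (b h) = a (ᵍb) (g h)`. -/
theorem SkewGroupAlgebra.mon_mul_mon (a b : A) (g h : G) :
    SkewGroupAlgebra.mon ρ a g * SkewGroupAlgebra.mon ρ b h =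
      SkewGroupAlgebra.mon ρ (a * ρ g b) (g * h) :=
  letI := actionOf ρ
  SkewMonoidAlgebra.single_mul_single

theorem SkewGroupAlgebra.mon_one_one : SkewGroupAlgebra.mon ρ (1 : A) (1 : G) = 1 := rfl

/-- The group elements of `A ⋊ G`. -/
def SkewGroupAlgebra.ofGroup : G →* SkewGroupAlgebra ρ where
  toFun g := SkewGroupAlgebra.mon ρ 1 g
  map_one' := SkewGroupAlgebra.mon_one_one ρ
  map_mul' g h := by simp [SkewGroupAlgebra.mon_mul_mon]

/-- The canonical map `K G → A ⋊ G`. -/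
def SkewGroupAlgebra.ofGroupAlgebra : MonoidAlgebra K G →ₐ[K] SkewGroupAlgebra ρ :=
  MonoidAlgebra.lift K (SkewGroupAlgebra ρ) G (SkewGroupAlgebra.ofGroup ρ)

end SkewGroupAlgebra

/-! ### Deformations over `K[t]` -/

section Deformation

attribute [local instance] Polynomial.algebra

/-- A deformation over `K[t]` of a `K`-algebra `A`: an associative `K[t]`-bilinear product `star`
on the `K[t]`-module `A[t]` with `a * b ≡ ab` modulo `t` for `a, b ∈ A`. By bilinearity it is
determined by the bilinear maps `μ i` defined below, through
`a * b = a b + μ₁(a, b) t + μ₂(a, b) t² + ⋯` (a finite sum). -/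
structure Deformation (K : Type*) [Field K] (A : Type*) [Ring A] [Algebra K A] where
  star : A[X] →ₗ[K[X]] A[X] →ₗ[K[X]] A[X]
  star_assoc : ∀ x y z, star (star x y) z = star x (star y z)
  coeff_zero_star : ∀ a b : A, (star (C a) (C b)).coeff 0 = a * b

namespace Deformation

variable {K : Type*} [Field K] {A : Type*} [Ring A] [Algebra K A]

theorem C_smul_eq (c : K) (a : A) : (C (c • a) : A[X]) = (C c : K[X]) • C a := by
  rw [Algebra.smul_def (C c : K[X]) (C a : A[X]), Polynomial.algebraMap_def, coe_mapRingHom,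
    map_C, ← C_mul, ← Algebra.smul_def]

theorem coeff_C_smul (c : K) (p : A[X]) (i : ℕ) :
    ((C c : K[X]) • p).coeff i = c • p.coeff i := by
  rw [Algebra.smul_def, Polynomial.algebraMap_def, coe_mapRingHom, map_C, coeff_C_mul,
    ← Algebra.smul_def]

/-- The bilinear map `μ i : A × A → A`, the coefficient of `t ^ i` in the deformed product. -/
def μ (D : Deformation K A) (i : ℕ) : A →ₗ[K] A →ₗ[K] A :=
  LinearMap.mk₂ K (fun a b => (D.star (C a) (C b)).coeff i)
    (fun a a' b => by simp)
    (fun c a b => by simp only [C_smul_eq, map_smul, LinearMap.smul_apply, coeff_C_smul])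
    (fun a b b' => by simp)
    (fun c a b => by simp only [C_smul_eq, map_smul, coeff_C_smul])

theorem μ_apply (D : Deformation K A) (i : ℕ) (a b : A) :
    D.μ i a b = (D.star (C a) (C b)).coeff i := rfl

theorem μ_zero (D : Deformation K A) (a b : A) : D.μ 0 a b = a * b :=
  D.coeff_zero_star a b

/-- `a * b = ∑ i, μ i (a, b) t ^ i`. -/
theorem star_C_C (D : Deformation K A) (a b : A) :
    D.star (C a) (C b) =
      ∑ i ∈ Finset.range ((D.star (C a) (C b)).natDegree + 1), C (D.μ i a b) * X ^ i :=
  as_sum_range_C_mul_X_pow _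

end Deformation

end Deformation

/-- A bilinear map `f` is homogeneous of degree `d` with respect to the family of homogeneous
components `𝒜`. -/
def IsHomogeneousBilinear {K : Type*} [Field K] {A : Type*} [Ring A] [Algebra K A]
    (𝒜 : ℤ → Submodule K A) (f : A →ₗ[K] A →ₗ[K] A) (d : ℤ) : Prop :=
  ∀ (p r : ℤ) (a b : A), a ∈ 𝒜 p → b ∈ 𝒜 r → f a b ∈ 𝒜 (p + r + d)

namespace TruncatedQDH

attribute [local instance] Polynomial.algebra

variable {K : Type*} [Field K] {n : ℕ} {V : Type*} [AddCommGroup V] [Module K V]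
  (v : Module.Basis (Fin n) K V) (q : Fin n → Fin n → K) (G : Subgroup (V ≃ₗ[K] V))

/-! ### The quantum exterior algebra and its skew group algebra -/

/-- The relations `v_j v_i = q_{ij} v_i v_j` for `i ≠ j` and `v_i ^ 2 = 0`; here
`K⟨v_1, …, v_n⟩` is the tensor algebra of `V`. -/
inductive ExteriorRel : TensorAlgebra K V → TensorAlgebra K V → Prop
  | comm (i j : Fin n) (hij : i ≠ j) :
      ExteriorRel (TensorAlgebra.ι K (v j) * TensorAlgebra.ι K (v i))
        (q i j • (TensorAlgebra.ι K (v i) * TensorAlgebra.ι K (v j)))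
  | sq (i : Fin n) : ExteriorRel (TensorAlgebra.ι K (v i) ^ 2) 0

/-- The quantum exterior algebra `Λ_q(V)`. -/
def QuantumExterior : Type _ := RingQuot (ExteriorRel v q)

instance QuantumExterior.instRing : Ring (QuantumExterior v q) :=
  inferInstanceAs (Ring (RingQuot (ExteriorRel v q)))

instance QuantumExterior.instAlgebra : Algebra K (QuantumExterior v q) :=
  inferInstanceAs (Algebra K (RingQuot (ExteriorRel v q)))

/-- The quotient map from the tensor algebra to `Λ_q(V)`. -/
def QuantumExterior.mk : TensorAlgebra K V →ₐ[K] QuantumExterior v q :=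
  RingQuot.mkAlgHom K (ExteriorRel v q)

/-- The canonical linear map `V → Λ_q(V)`. -/
def QuantumExterior.ι : V →ₗ[K] QuantumExterior v q :=
  (QuantumExterior.mk v q).toLinearMap ∘ₗ TensorAlgebra.ι K

variable {v q G} in
/-- The action `ρ` of `G` on `Λ_q(V)` by algebra automorphisms extends the action of `G` on `V`. -/
def ExtendsAction (ρ : G →* (QuantumExterior v q ≃ₐ[K] QuantumExterior v q)) : Prop :=
  ∀ (g : G) (x : V), ρ g (QuantumExterior.ι v q x) = QuantumExterior.ι v q ((g : V ≃ₗ[K] V) x)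

variable {v q G} in
/-- The element `v_i` of `Λ_q(V) ⋊ G`. -/
def extGen (ρ : G →* (QuantumExterior v q ≃ₐ[K] QuantumExterior v q)) (i : Fin n) :
    SkewGroupAlgebra ρ :=
  SkewGroupAlgebra.mon ρ (QuantumExterior.ι v q (v i)) 1

variable {v q G} in
/-- The homogeneous component of degree `d` of `Λ_q(V) ⋊ G`, where the elements of `V` have
degree `1` and those of `G` degree `0`: it is spanned by the `x_1 ⋯ x_d g` with `x_k ∈ V` and
`g ∈ G`, and it is zero for `d < 0`. -/
def skewDegree (ρ : G →* (QuantumExterior v q ≃ₐ[K] QuantumExterior v q)) (d : ℤ) :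
    Submodule K (SkewGroupAlgebra ρ) :=
  Submodule.span K {y | ∃ p : ℕ, (p : ℤ) = d ∧
    ∃ a ∈ LinearMap.range (QuantumExterior.ι v q) ^ p, ∃ g : G, y = SkewGroupAlgebra.mon ρ a g}

/-! ### Truncated quantum Drinfeld Hecke algebras -/

/-- The action of `G` on the tensor algebra `T(V)` induced by the action on `V`. -/
def tensorAction : G →* (TensorAlgebra K V ≃ₐ[K] TensorAlgebra K V) where
  toFun g := AlgEquiv.ofAlgHom
    (TensorAlgebra.lift K (TensorAlgebra.ι K ∘ₗ ((g : V ≃ₗ[K] V) : V →ₗ[K] V)))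
    (TensorAlgebra.lift K (TensorAlgebra.ι K ∘ₗ ((g : V ≃ₗ[K] V).symm : V →ₗ[K] V)))
    (by ext x; simp) (by ext x; simp)
  map_one' := by
    apply AlgEquiv.coe_toAlgHom_injective
    ext x; simp
  map_mul' g h := by
    apply AlgEquiv.coe_toAlgHom_injective
    ext x; simp

/-- The skew group algebra `T(V) ⋊ G`. -/
abbrev TensorSkew : Type _ := SkewGroupAlgebra (tensorAction G)

/-- The element `v_i` of `T(V) ⋊ G`. -/
def tensorGen (i : Fin n) : TensorSkew G :=
  SkewGroupAlgebra.mon (tensorAction G) (TensorAlgebra.ι K (v i)) 1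

variable {G} (κ : V →ₗ[K] V →ₗ[K] MonoidAlgebra K G)

/-- The relations `v_j v_i = q_{ij} v_i v_j + κ(v_i, v_j) t` for all `i, j`, and `v_i ^ 2 = 0`, on
`(T(V) ⋊ G)[t]`. -/
inductive HeckeRel : (TensorSkew G)[X] → (TensorSkew G)[X] → Prop
  | comm (i j : Fin n) :
      HeckeRel (C (tensorGen v G j * tensorGen v G i))
        (C (q i j • (tensorGen v G i * tensorGen v G j)) +
          C (SkewGroupAlgebra.ofGroupAlgebra (tensorAction G) (κ (v i) (v j))) * X)
  | sq (i : Fin n) : HeckeRel (C (tensorGen v G i ^ 2)) 0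

/-- The `K[t]`-algebra `Ĥ_{q,κ,t} = (T(V) ⋊ G)[t] / (v_j v_i - q_{ij} v_i v_j - κ(v_i, v_j) t, v_i²)`.
-/
def HeckeAlgebra : Type _ := RingQuot (HeckeRel v q κ)

instance HeckeAlgebra.instRing : Ring (HeckeAlgebra v q κ) :=
  inferInstanceAs (Ring (RingQuot (HeckeRel v q κ)))

instance HeckeAlgebra.instAlgebra : Algebra K[X] (HeckeAlgebra v q κ) :=
  inferInstanceAs (Algebra K[X] (RingQuot (HeckeRel v q κ)))

/-- The quotient map `(T(V) ⋊ G)[t] → Ĥ_{q,κ,t}`. -/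
def HeckeAlgebra.mk : (TensorSkew G)[X] →ₐ[K[X]] HeckeAlgebra v q κ :=
  RingQuot.mkAlgHom K[X] (HeckeRel v q κ)

/-- The image of `v_i` in `Ĥ_{q,κ,t}`. -/
def heckeGen (i : Fin n) : HeckeAlgebra v q κ :=
  HeckeAlgebra.mk v q κ (C (tensorGen v G i))

/-- The image of `g ∈ G` in `Ĥ_{q,κ,t}`. -/
def heckeGroup (g : G) : HeckeAlgebra v q κ :=
  HeckeAlgebra.mk v q κ (C (SkewGroupAlgebra.ofGroup (tensorAction G) g))

/-- The element `v_1^{α_1} v_2^{α_2} ⋯ v_n^{α_n} g` of `Ĥ_{q,κ,t}`, where `α_i ∈ {0, 1}`. -/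
def pbwMonomial (αg : (Fin n → Fin 2) × G) : HeckeAlgebra v q κ :=
  (List.ofFn fun i => heckeGen v q κ i ^ (αg.1 i : ℕ)).prod * heckeGroup v q κ αg.2

/-- `Ĥ_{q,κ,t}` is a truncated quantum Drinfeld Hecke algebra over `K[t]`: it has the PBW basis
`{v_1^{α_1} ⋯ v_n^{α_n} g}` over `K[t]`. -/
def IsTruncatedQDH : Prop :=
  LinearIndependent K[X] (pbwMonomial v q κ) ∧
    Submodule.span K[X] (Set.range (pbwMonomial v q κ)) = ⊤

variable {v q} in
/-- The `K[t]`-algebra `Ĥ_{q,κ,t}` is isomorphic to the deformation `D` of `Λ_q(V) ⋊ G`, by an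
isomorphism that sends `v_i` to `v_i` and `g` to `g`. As `1 ∈ G`, it also carries the unit of
`Ĥ_{q,κ,t}` to `1`, which is then the unit of `D`. -/
def IsoDeformation {ρ : G →* (QuantumExterior v q ≃ₐ[K] QuantumExterior v q)}
    (D : Deformation K (SkewGroupAlgebra ρ)) : Prop :=
  ∃ e : HeckeAlgebra v q κ ≃ₗ[K[X]] (SkewGroupAlgebra ρ)[X],
    (∀ x y, e (x * y) = D.star (e x) (e y)) ∧
    (∀ i, e (heckeGen v q κ i) = C (extGen ρ i)) ∧
    ∀ g, e (heckeGroup v q κ g) = C (SkewGroupAlgebra.ofGroup ρ g)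

end TruncatedQDH

end

/-! Write `Ĥ` for the Hecke algebra. Both directions compare `Ĥ` with the free `K[t]`-module
`(Λ_q(V) ⋊ G)[t]`, where `V` has degree 1, `G` degree 0 and `t` degree 2; the relations of `Ĥ` are
homogeneous for these degrees. Three facts hold before any PBW assumption: the ordered monomials
span `Ĥ` (`span_pbwMonomial`); if `q_{ij} q_{ji} = 1`, the ordered monomials are a basis of `Λ_q(V)`
(`linearIndependent_monomial`); and `Ĥ` has a universal property in which `t` may go to any central
element (`heckeLift`).

Suppose that `Ĥ` has a PBW basis. Commuting `v_i v_j` twice and comparing coefficients gives `q_{ij}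
q_{ji} = 1`. Modulo `t` the PBW monomials stay independent over `K`, so `Λ_q(V)` embeds in `Ĥ / tĤ`;
conjugation by `g` preserves the relations there, hence `G` acts on `Λ_q(V)`. Matching bases
transports the product of `Ĥ` to `(Λ_q(V) ⋊ G)[t]`. The homomorphism with `t ↦ 0` shows that it
reduces to the undeformed product, and the homomorphism `Ĥ → Ĥ[s]` with `v ↦ v s`, `t ↦ t s²` gives
the degree of each `μ_i`.

Conversely, let `D` be a graded deformation. In total degree below 2 its product is undeformed, and
below 4 only `μ_1` intervenes. So `1` is the unit, `G` multiplies and moves past `V` as before, and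
the commutation error of `v_j` and `v_i` is `t` times an element of degree 0, that is, of `KG`. This
defines `κ` and a homomorphism `Ĥ → D`. It is onto by induction on degree, since a PBW monomial maps
to the corresponding basis monomial plus terms `t^m a` with `a` of lower degree. As `G` is finite,
`D` is free of finite rank, and a surjective endomorphism of such a module is injective. So the
images of the spanning PBW monomials are independent, which gives both the PBW basis and the
isomorphism. -/

noncomputable section

/-! ### Skew group algebras: universal property and bases. -/

namespace SkewGroupAlgebra

variable {K : Type*} [Field K] {A : Type*} [Ring A] [Algebra K A] {G : Type*} [Group G]
  (ρ : G →* (A ≃ₐ[K] A))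

/-- `A ⋊ G` is the direct sum of the `A g`. -/
def coeffEquiv : SkewGroupAlgebra ρ ≃ₗ[K] (G →₀ A) :=
  letI := actionOf ρ
  SkewMonoidAlgebra.coeffLinearEquiv

theorem coeffEquiv_mon (a : A) (g : G) : coeffEquiv ρ (mon ρ a g) = Finsupp.single g a := rfl

theorem coeffEquiv_symm_single (a : A) (g : G) :
    (coeffEquiv ρ).symm (Finsupp.single g a) = mon ρ a g := rfl

/-- The map `a ↦ a g` from `A` to `A ⋊ G`. -/
def monLinear (g : G) : A →ₗ[K] SkewGroupAlgebra ρ :=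
  (coeffEquiv ρ).symm.toLinearMap ∘ₗ Finsupp.lsingle g

theorem monLinear_apply (a : A) (g : G) : monLinear ρ g a = mon ρ a g := rfl

/-- The inclusion of `A` into `A ⋊ G`. -/
def ofBase : A →ₐ[K] SkewGroupAlgebra ρ :=
  AlgHom.ofLinearMap (monLinear ρ 1) (mon_one_one ρ) fun a b => by
    simp [monLinear_apply, mon_mul_mon]

theorem ofBase_apply (a : A) : ofBase ρ a = mon ρ a 1 := rfl

theorem ofGroup_apply (g : G) : ofGroup ρ g = mon ρ 1 g := rfl

theorem mon_eq_mul (a : A) (g : G) : mon ρ a g = ofBase ρ a * ofGroup ρ g := by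
  simp [ofBase_apply, ofGroup_apply, mon_mul_mon]

theorem ofGroup_mul_ofBase (g : G) (a : A) :
    ofGroup ρ g * ofBase ρ a = ofBase ρ (ρ g a) * ofGroup ρ g := by
  simp [ofBase_apply, ofGroup_apply, mon_mul_mon]

variable {ρ} in
theorem induction_on {P : SkewGroupAlgebra ρ → Prop} (x : SkewGroupAlgebra ρ)
    (hmon : ∀ a g, P (mon ρ a g)) (hadd : ∀ x y, P x → P y → P (x + y)) : P x := by
  obtain ⟨f, rfl⟩ := (coeffEquiv ρ).symm.surjective x
  induction f using Finsupp.induction_linear with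
  | zero => rw [map_zero, ← (monLinear ρ (1 : G)).map_zero]; exact hmon 0 1
  | add f g hf hg => rw [map_add]; exact hadd _ _ hf hg
  | single g a => exact hmon a g

variable {B : Type*} [Ring B] [Algebra K B]

/-- The universal property of `A ⋊ G`. -/
def lift (f : A →ₐ[K] B) (u : G →* B) (h : ∀ g a, u g * f a = f (ρ g a) * u g) :
    SkewGroupAlgebra ρ →ₐ[K] B :=
  letI := actionOf ρ
  haveI : SMulCommClass G K A := ⟨fun g c a => map_smul (ρ g) c a⟩
  SkewMonoidAlgebra.liftNCAlgHom f u fun {x y} => (h y x).symm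

theorem lift_mon (f : A →ₐ[K] B) (u : G →* B) (h : ∀ g a, u g * f a = f (ρ g a) * u g)
    (a : A) (g : G) : lift ρ f u h (mon ρ a g) = f a * u g :=
  letI := actionOf ρ
  SkewMonoidAlgebra.liftNC_single _ _ _ _

/-- The basis `b_i g` of `A ⋊ G` for a basis `b_i` of `A`. -/
def basis {ι : Type*} (b : Module.Basis ι K A) : Module.Basis (ι × G) K (SkewGroupAlgebra ρ) :=
  ((Finsupp.basis fun _ : G => b).map (coeffEquiv ρ).symm).reindex
    ((Equiv.sigmaEquivProd G ι).trans (Equiv.prodComm G ι))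

theorem basis_apply {ι : Type*} (b : Module.Basis ι K A) (k : ι × G) :
    basis ρ b k = mon ρ (b k.1) k.2 := by
  simp [basis, Finsupp.coe_basis, coeffEquiv_symm_single]

theorem basis_repr_mon {ι : Type*} (b : Module.Basis ι K A) (a : A) (g h : G) (i : ι) :
    (basis ρ b).repr (mon ρ a g) (i, h) = (Finsupp.single g (b.repr a i)) h := by
  classical
  simp only [basis, Module.Basis.repr_reindex, Module.Basis.map_repr, LinearEquiv.symm_symm,
    LinearEquiv.trans_apply, coeffEquiv_mon, Finsupp.mapDomain_equiv_apply]
  simp [Finsupp.basis, Finsupp.single_apply]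
  split_ifs <;> simp

end SkewGroupAlgebra

/-! ### Straightening words into ordered monomials. -/

section Straightening

variable {k : Type*} [CommRing k] {R : Type*} [Ring R] [Algebra k R] {n : ℕ} (x : Fin n → R)
  {Γ : Type*} [Monoid Γ] (u : Γ →* R)

/-- Exponents in `{0, 1}` amount to a subset of the letters; as a filtered list, a monomial can be
compared with words. -/
theorem prod_ofFn_pow_eq (α : Fin n → Fin 2) :
    (List.ofFn fun i => x i ^ (α i : ℕ)).prod =
      (((List.finRange n).filter fun i => α i = 1).map x).prod := by
  rw [List.ofFn_eq_map]
  induction List.finRange n with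
  | nil => simp
  | cons a l ih =>
    rw [List.map_cons, List.prod_cons, ih, List.filter_cons]
    rcases Fin.exists_fin_two.1 ⟨α a, rfl⟩ with h | h <;> simp [h]

/-- The ordered monomial `x_1^{α_1} ⋯ x_n^{α_n} g`. -/
def orderedMonomial (p : (Fin n → Fin 2) × Γ) : R :=
  (List.ofFn fun i => x i ^ (p.1 i : ℕ)).prod * u p.2

variable (k) in
/-- The span of the words `x_{i_1} ⋯ x_{i_m} g` of length `m < d`. -/
def wordSpan (d : ℕ) : Submodule k R :=
  Submodule.span k {y | ∃ l : List (Fin n), l.length < d ∧ ∃ g, y = (l.map x).prod * u g}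

theorem wordSpan_mono {d e : ℕ} (h : d ≤ e) : wordSpan k x u d ≤ wordSpan k x u e :=
  Submodule.span_mono fun _ ⟨l, hl, g, hy⟩ => ⟨l, hl.trans_le h, g, hy⟩

theorem gen_mul_mem_wordSpan (i : Fin n) {d : ℕ} {y : R} (hy : y ∈ wordSpan k x u d) :
    x i * y ∈ wordSpan k x u (d + 1) := by
  induction hy using Submodule.span_induction with
  | mem y hy =>
    obtain ⟨l, hl, g, rfl⟩ := hy
    exact Submodule.subset_span ⟨i :: l, by simpa using hl, g, by simp [mul_assoc]⟩
  | zero => simp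
  | add y z _ _ hy hz => rw [mul_add]; exact add_mem hy hz
  | smul c y _ hy => rw [mul_smul_comm]; exact Submodule.smul_mem _ _ hy

theorem mul_group_mem_wordSpan (h : Γ) {d : ℕ} {y : R} (hy : y ∈ wordSpan k x u d) :
    y * u h ∈ wordSpan k x u d := by
  induction hy using Submodule.span_induction with
  | mem y hy =>
    obtain ⟨l, hl, g, rfl⟩ := hy
    exact Submodule.subset_span ⟨l, hl, g * h, by simp [mul_assoc]⟩
  | zero => simp
  | add y z _ _ hy hz => rw [add_mul]; exact add_mem hy hz
  | smul c y _ hy => rw [smul_mul_assoc]; exact Submodule.smul_mem _ _ hy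

variable {x u}

/-- Moving a group element past a letter replaces the letter by a combination of letters, so lengths
do not grow. The `+ 1` only reflects the strict bound in `wordSpan`. -/
theorem group_mul_word_mem_wordSpan
    (hu : ∀ g i, u g * x i ∈ Submodule.span k (Set.range fun j => x j * u g))
    (h : Γ) (l : List (Fin n)) : u h * (l.map x).prod ∈ wordSpan k x u (l.length + 1) := by
  induction l with
  | nil => exact Submodule.subset_span ⟨[], by simp, h, by simp⟩
  | cons i l ih =>
    rw [List.map_cons, List.prod_cons, ← mul_assoc, List.length_cons]
    have hz := hu h i
    generalize u h * x i = z at hz ⊢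
    induction hz using Submodule.span_induction with
    | mem z hz =>
      obtain ⟨j, rfl⟩ := hz
      simpa only [mul_assoc] using gen_mul_mem_wordSpan x u j ih
    | zero => simp
    | add y z _ _ hy hz => rw [add_mul]; exact add_mem hy hz
    | smul c y _ hy => rw [smul_mul_assoc]; exact Submodule.smul_mem _ _ hy

theorem group_mul_mem_wordSpan
    (hu : ∀ g i, u g * x i ∈ Submodule.span k (Set.range fun j => x j * u g))
    (h : Γ) {d : ℕ} {y : R} (hy : y ∈ wordSpan k x u d) : u h * y ∈ wordSpan k x u d := by
  induction hy using Submodule.span_induction with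
  | mem y hy =>
    obtain ⟨l, hl, g, rfl⟩ := hy
    rw [← mul_assoc]
    exact mul_group_mem_wordSpan x u g
      (wordSpan_mono x u (Nat.succ_le_of_lt hl) (group_mul_word_mem_wordSpan hu h l))
  | zero => simp
  | add y z _ _ hy hz => rw [mul_add]; exact add_mem hy hz
  | smul c y _ hy => rw [mul_smul_comm]; exact Submodule.smul_mem _ _ hy

variable {q : Fin n → Fin n → k}

/-- Permuting the letters of a word multiplies it by a scalar, up to shorter words. -/
theorem exists_word_sub_smul_mem_wordSpan
    (hu : ∀ g i, u g * x i ∈ Submodule.span k (Set.range fun j => x j * u g))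
    (hx : ∀ i j, i ≠ j → x j * x i - q i j • (x i * x j) ∈ Submodule.span k (Set.range u))
    {l l' : List (Fin n)} (h : l.Perm l') :
    ∃ c : k, (l.map x).prod - c • (l'.map x).prod ∈ wordSpan k x u l.length := by
  induction h with
  | nil => exact ⟨1, by simp⟩
  | @cons a l l' _ ih =>
    obtain ⟨c, hc⟩ := ih
    refine ⟨c, ?_⟩
    simpa [mul_sub] using gen_mul_mem_wordSpan x u a hc
  | swap i j l =>
    rcases eq_or_ne i j with rfl | hij
    · exact ⟨1, by simp⟩
    refine ⟨q i j, ?_⟩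
    have key : (x j * x i - q i j • (x i * x j)) * (l.map x).prod
        ∈ wordSpan k x u (l.length + 1) := by
      have hz := hx i j hij
      generalize x j * x i - q i j • (x i * x j) = z at hz ⊢
      induction hz using Submodule.span_induction with
      | mem z hz => obtain ⟨g, rfl⟩ := hz; exact group_mul_word_mem_wordSpan hu g l
      | zero => simp
      | add y z _ _ hy hz => rw [add_mul]; exact add_mem hy hz
      | smul c y _ hy => rw [smul_mul_assoc]; exact Submodule.smul_mem _ _ hy
    -- The word has length `l.length + 2`, and the correction trades two letters for group elements,
    -- so the bound holds with room to spare.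
    have := wordSpan_mono x u (Nat.le_succ _) key
    simpa [sub_mul, mul_assoc] using this
  | @trans l₁ l₂ l₃ h₁₂ _ ih₁ ih₂ =>
    obtain ⟨c, hc⟩ := ih₁
    obtain ⟨e, he⟩ := ih₂
    refine ⟨c * e, ?_⟩
    rw [← h₁₂.length_eq] at he
    have := add_mem hc (Submodule.smul_mem _ c he)
    rwa [smul_sub, sub_add_sub_cancel, smul_smul] at this

/-- Induction on length: modulo shorter words, a word may be reordered at the cost of a scalar.
Without repetition it becomes an ordered monomial; otherwise two equal letters can be brought side
by side, and their square is zero. -/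
theorem wordSpan_le_span_orderedMonomial
    (hu : ∀ g i, u g * x i ∈ Submodule.span k (Set.range fun j => x j * u g))
    (hx : ∀ i j, i ≠ j → x j * x i - q i j • (x i * x j) ∈ Submodule.span k (Set.range u))
    (hsq : ∀ i, x i * x i = 0) (d : ℕ) :
    wordSpan k x u d ≤ Submodule.span k (Set.range (orderedMonomial x u)) := by
  induction d with
  | zero =>
    refine Submodule.span_le.2 ?_
    rintro _ ⟨l, hl, -⟩
    simp at hl
  | succ d ih =>
    refine Submodule.span_le.2 ?_
    rintro _ ⟨l, hl, g, rfl⟩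
    have key : ∀ l', l.Perm l' →
        (l'.map x).prod * u g ∈ Submodule.span k (Set.range (orderedMonomial x u)) →
        (l.map x).prod * u g ∈ Submodule.span k (Set.range (orderedMonomial x u)) := by
      intro l' hl' hmem
      obtain ⟨c, hc⟩ := exists_word_sub_smul_mem_wordSpan hu hx hl'
      have h1 := ih (wordSpan_mono x u (Nat.le_of_lt_succ hl) (mul_group_mem_wordSpan x u g hc))
      have h2 := add_mem h1 (Submodule.smul_mem _ c hmem)
      rwa [sub_mul, smul_mul_assoc, sub_add_cancel] at h2
    by_cases hnd : l.Nodup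
    · refine key ((List.finRange n).filter fun i => (if i ∈ l then 1 else 0 : Fin 2) = 1) ?_
        (Submodule.subset_span ⟨(fun i => if i ∈ l then 1 else 0, g), ?_⟩)
      · rw [List.perm_ext_iff_of_nodup hnd ((List.nodup_finRange n).filter _)]
        simp
      · rw [orderedMonomial, prod_ofFn_pow_eq]
    · rw [List.nodup_iff_sublist] at hnd
      push Not at hnd
      obtain ⟨a, ha⟩ := hnd
      obtain ⟨l', hl'⟩ := ha.exists_perm_append
      refine key _ hl' ?_
      simp [← mul_assoc, hsq]

/-- The span of all words contains `1` and is stable under left multiplication by generators, hence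
is everything. The generality serves two cases: trivial `Γ` over `K` for `Λ_q(V)`, and `Γ = G` over
`K[t]` for `Ĥ`. -/
theorem span_orderedMonomial_eq_top
    (hu : ∀ g i, u g * x i ∈ Submodule.span k (Set.range fun j => x j * u g))
    (hx : ∀ i j, i ≠ j → x j * x i - q i j • (x i * x j) ∈ Submodule.span k (Set.range u))
    (hsq : ∀ i, x i * x i = 0)
    (hgen : Algebra.adjoin k (Set.range x ∪ Set.range u) = ⊤) :
    Submodule.span k (Set.range (orderedMonomial x u)) = ⊤ := by
  rw [eq_top_iff]
  have key : ∀ y : R, ∀ d, ∀ z ∈ wordSpan k x u d, ∃ e, y * z ∈ wordSpan k x u e := by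
    intro y
    have hy : y ∈ Algebra.adjoin k (Set.range x ∪ Set.range u) := hgen ▸ Algebra.mem_top
    induction hy using Algebra.adjoin_induction with
    | mem y hy =>
      intro d z hz
      rcases hy with ⟨i, rfl⟩ | ⟨g, rfl⟩
      · exact ⟨d + 1, gen_mul_mem_wordSpan x u i hz⟩
      · exact ⟨d, group_mul_mem_wordSpan hu g hz⟩
    | algebraMap c =>
      intro d z hz
      exact ⟨d, by rw [← Algebra.smul_def]; exact Submodule.smul_mem _ _ hz⟩
    | add a b _ _ ha hb =>
      intro d z hz
      obtain ⟨e, he⟩ := ha d z hz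
      obtain ⟨f, hf⟩ := hb d z hz
      refine ⟨max e f, ?_⟩
      rw [add_mul]
      exact add_mem (wordSpan_mono x u (le_max_left _ _) he)
        (wordSpan_mono x u (le_max_right _ _) hf)
    | mul a b _ _ ha hb =>
      intro d z hz
      obtain ⟨e, he⟩ := hb d z hz
      rw [mul_assoc]
      exact ha e _ he
  intro y _
  obtain ⟨e, he⟩ := key y 1 1 (Submodule.subset_span ⟨[], by simp, 1, by simp⟩)
  rw [mul_one] at he
  exact wordSpan_le_span_orderedMonomial hu hx hsq e he

end Straightening

/-! ### The quantum exterior algebra and its monomial basis. -/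

namespace TruncatedQDH

variable {K : Type*} [Field K] {n : ℕ} {V : Type*} [AddCommGroup V] [Module K V]
  (v : Module.Basis (Fin n) K V) (q : Fin n → Fin n → K)

namespace QuantumExterior

theorem ι_mul_ι {i j : Fin n} (hij : i ≠ j) :
    ι v q (v j) * ι v q (v i) = q i j • (ι v q (v i) * ι v q (v j)) := by
  have h : mk v q _ = mk v q _ := RingQuot.mkAlgHom_rel K (ExteriorRel.comm i j hij)
  rwa [map_mul, map_smul, map_mul] at h

theorem ι_mul_self (i : Fin n) : ι v q (v i) * ι v q (v i) = 0 := by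
  have h : mk v q _ = mk v q _ := RingQuot.mkAlgHom_rel K (ExteriorRel.sq i)
  rwa [pow_two, map_mul, map_zero] at h

variable {B : Type*} [Ring B] [Algebra K B]

variable {v q} in
/-- The universal property of `Λ_q(V)`. -/
def lift (f : V →ₗ[K] B)
    (hf : ∀ i j, i ≠ j → f (v j) * f (v i) = q i j • (f (v i) * f (v j)))
    (hsq : ∀ i, f (v i) * f (v i) = 0) : QuantumExterior v q →ₐ[K] B :=
  RingQuot.liftAlgHom K ⟨TensorAlgebra.lift K f, fun a b hab => by
    cases hab with
    | comm i j hij => simpa using hf i j hij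
    | sq i => simpa [pow_two] using hsq i⟩

theorem lift_ι (f : V →ₗ[K] B)
    (hf : ∀ i j, i ≠ j → f (v j) * f (v i) = q i j • (f (v i) * f (v j)))
    (hsq : ∀ i, f (v i) * f (v i) = 0) (x : V) : lift f hf hsq (ι v q x) = f x :=
  (RingQuot.liftAlgHom_mkAlgHom_apply K _ _ _).trans (TensorAlgebra.lift_ι_apply f x)

variable {v q} in
theorem algHom_ext {f g : QuantumExterior v q →ₐ[K] B}
    (h : ∀ x, f (ι v q x) = g (ι v q x)) : f = g :=
  RingQuot.ringQuot_ext' K f g (TensorAlgebra.hom_ext (LinearMap.ext h))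

theorem adjoin_range_ι_basis : Algebra.adjoin K (Set.range fun i => ι v q (v i)) = ⊤ := by
  rw [eq_top_iff]
  rintro x -
  obtain ⟨y, rfl⟩ := RingQuot.mkAlgHom_surjective K _ x
  change mk v q y ∈ _
  induction y using TensorAlgebra.induction with
  | algebraMap r => rw [AlgHom.commutes]; exact Subalgebra.algebraMap_mem _ _
  | ι x =>
    change ι v q x ∈ _
    rw [← v.sum_repr x, map_sum]
    refine Subalgebra.sum_mem _ fun i _ => ?_
    rw [map_smul]
    exact Subalgebra.smul_mem _ (Algebra.subset_adjoin (Set.mem_range_self i)) _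
  | mul a b ha hb => rw [map_mul]; exact mul_mem ha hb
  | add a b ha hb => rw [map_add]; exact add_mem ha hb

/-- The ordered monomial `v_1^{α_1} ⋯ v_n^{α_n}` of `Λ_q(V)`. -/
def monomial (α : Fin n → Fin 2) : QuantumExterior v q :=
  (List.ofFn fun i => ι v q (v i) ^ (α i : ℕ)).prod

theorem span_monomial : Submodule.span K (Set.range (monomial v q)) = ⊤ := by
  have h := span_orderedMonomial_eq_top (k := K) (x := fun i => ι v q (v i))
    (u := (1 : Unit →* QuantumExterior v q)) (q := q)
    (fun _ i => Submodule.subset_span ⟨i, by simp⟩)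
    (fun i j hij => by rw [ι_mul_ι v q hij, sub_self]; exact zero_mem _)
    (ι_mul_self v q)
    (by
      rw [eq_top_iff, ← adjoin_range_ι_basis v q]
      exact Algebra.adjoin_mono Set.subset_union_left)
  rw [eq_top_iff, ← h]
  refine Submodule.span_mono ?_
  rintro _ ⟨p, rfl⟩
  exact ⟨p.1, by simp [monomial, orderedMonomial]⟩

/-! #### Linear independence of the ordered monomials -/

/-- The action of `v_i` on the space with basis the subsets of `{1, …, n}`. -/
def insertion (q : Fin n → Fin n → K) (i : Fin n) : Module.End K (Finset (Fin n) →₀ K) :=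
  Finsupp.linearCombination K fun S =>
    -- The scalar is the cost of moving `v_i` rightwards to its place, past the smaller letters, by
    -- `v_i v_j = q_{ji} v_j v_i`.
    if i ∈ S then 0 else Finsupp.single (insert i S) (∏ j ∈ S with j < i, q j i)

theorem insertion_single (i : Fin n) (S : Finset (Fin n)) (c : K) :
    insertion q i (Finsupp.single S c) =
      if i ∈ S then 0 else Finsupp.single (insert i S) (c * ∏ j ∈ S with j < i, q j i) := by
  rw [insertion, Finsupp.linearCombination_single]
  split_ifs <;> simp

variable {q}

theorem insertion_mul_self (i : Fin n) : insertion q i * insertion q i = 0 := by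
  ext S : 2
  simp only [LinearMap.comp_apply, Finsupp.lsingle_apply, Module.End.mul_apply, insertion_single]
  split_ifs with h <;> simp [insertion_single]

theorem prod_filter_insert_of_lt {i j : Fin n} (hij : i < j) {S : Finset (Fin n)} (hi : i ∉ S) :
    ∏ a ∈ insert i S with a < j, q a j = q i j * ∏ a ∈ S with a < j, q a j := by
  rw [Finset.filter_insert, if_pos hij, Finset.prod_insert (by simp [hi])]

theorem prod_filter_insert_of_gt {i j : Fin n} (hij : j < i) (S : Finset (Fin n)) :
    ∏ a ∈ insert i S with a < j, q a j = ∏ a ∈ S with a < j, q a j := by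
  rw [Finset.filter_insert, if_neg hij.not_gt]

/-- On a subset avoiding `i` and `j` both orders produce the same subset. The scalars differ only
when the larger index is inserted second: it then also passes the smaller one. -/
theorem insertion_mul_insertion (hqq : ∀ i j, i ≠ j → q i j * q j i = 1) {i j : Fin n}
    (hij : i ≠ j) :
    insertion q j * insertion q i = q i j • (insertion q i * insertion q j) := by
  ext S : 2
  simp only [LinearMap.comp_apply, Finsupp.lsingle_apply, Module.End.mul_apply, insertion_single,
    LinearMap.smul_apply]
  by_cases hi : i ∈ S
  · by_cases hj : j ∈ S <;> simp [hi, hj, insertion_single]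
  by_cases hj : j ∈ S
  · simp [hi, hj, insertion_single]
  simp only [hi, hj, if_false, insertion_single, Finset.mem_insert, hij, hij.symm, or_self,
    Finsupp.smul_single, smul_eq_mul]
  rw [Finset.insert_comm j i S]
  congr 1
  rcases lt_or_gt_of_ne hij with h | h
  · rw [prod_filter_insert_of_lt h hi, prod_filter_insert_of_gt h]
    ring
  · rw [prod_filter_insert_of_lt h hj, prod_filter_insert_of_gt h]
    -- Here `j < i`, and the right-hand side carries the extra factor `q i j * q j i`; the
    -- coefficient `1 - 2` is just the sign `-1`.
    linear_combination (1 - 2 : K) * (∏ a ∈ S with a < i, q a i) *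
      (∏ a ∈ S with a < j, q a j) * hqq i j hij

/-- In an increasing word each letter is inserted below all those already present, so every product
of scalars is empty. -/
theorem prod_insertion_apply {l : List (Fin n)} (hl : l.Pairwise (· < ·)) :
    (l.map (insertion q)).prod (Finsupp.single ∅ 1) = Finsupp.single l.toFinset 1 := by
  induction l with
  | nil => simp
  | cons a l ih =>
    rw [List.pairwise_cons] at hl
    rw [List.map_cons, List.prod_cons, Module.End.mul_apply, ih hl.2, insertion_single, if_neg,
      Finset.filter_false_of_mem]
    · simp
    · intro b hb
      exact (hl.1 b (List.mem_toFinset.1 hb)).not_gt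
    · intro h
      exact lt_irrefl _ (hl.1 a (List.mem_toFinset.1 h))

/-- The insertion operators represent `Λ_q(V)`, and applying distinct ordered monomials to the empty
subset gives distinct basis vectors. -/
theorem linearIndependent_monomial (hqq : ∀ i j, i ≠ j → q i j * q j i = 1) :
    LinearIndependent K (monomial v q) := by
  let Φ : QuantumExterior v q →ₐ[K] Module.End K (Finset (Fin n) →₀ K) :=
    lift (v.constr K (insertion q))
      (fun i j hij => by simpa using insertion_mul_insertion hqq hij)
      (fun i => by simpa using insertion_mul_self i)
  have hΦ : ∀ i, Φ (ι v q (v i)) = insertion q i := fun i => by simp [Φ, lift_ι]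
  refine LinearIndependent.of_comp
    (LinearMap.applyₗ (Finsupp.single (∅ : Finset (Fin n)) (1 : K)) ∘ₗ Φ.toLinearMap) ?_
  let s : (Fin n → Fin 2) → Finset (Fin n) := fun α => {i | α i = 1}
  have hs : Function.Injective s := by
    intro α β h
    funext i
    have : α i = 1 ↔ β i = 1 := by simpa [s] using Finset.ext_iff.1 h i
    omega
  have h := (Finsupp.basisSingleOne (R := K) (ι := Finset (Fin n))).linearIndependent.comp s hs
  convert h using 1
  funext α
  simp only [Function.comp_apply, LinearMap.comp_apply, AlgHom.toLinearMap_apply,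
    LinearMap.applyₗ_apply_apply, Finsupp.coe_basisSingleOne]
  rw [monomial, prod_ofFn_pow_eq, map_list_prod, List.map_map]
  have hc : (Φ ∘ fun i => ι v q (v i)) = insertion q := funext hΦ
  rw [hc, prod_insertion_apply ((List.pairwise_lt_finRange n).filter _)]
  congr 1
  ext i
  simp [s]

/-- The basis of ordered monomials of `Λ_q(V)`. -/
def basis (hqq : ∀ i j, i ≠ j → q i j * q j i = 1) :
    Module.Basis (Fin n → Fin 2) K (QuantumExterior v q) :=
  Module.Basis.mk (linearIndependent_monomial v hqq) (span_monomial v q).ge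

theorem basis_apply (hqq : ∀ i j, i ≠ j → q i j * q j i = 1) (α : Fin n → Fin 2) :
    basis v hqq α = monomial v q α := by
  simp [basis]

end QuantumExterior

/-! #### The grading -/

/-- The degree `α_1 + ⋯ + α_n` of an ordered monomial. -/
def monomialDegree (α : Fin n → Fin 2) : ℕ := ∑ i, (α i : ℕ)

namespace QuantumExterior

theorem monomial_mem_pow (α : Fin n → Fin 2) :
    monomial v q α ∈ LinearMap.range (ι v q) ^ monomialDegree α := by
  rw [monomial, monomialDegree, ← List.sum_ofFn, List.ofFn_eq_map, List.ofFn_eq_map]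
  induction List.finRange n with
  | nil => exact Submodule.one_le.1 le_rfl
  | cons a l ih =>
    rw [List.map_cons, List.map_cons, List.prod_cons, List.sum_cons, pow_add]
    exact Submodule.mul_mem_mul (Submodule.pow_mem_pow _ (LinearMap.mem_range_self _ _) _) ih

/-- The algebra map `Λ_q(V) → Λ_q(V)[s]` that sends `x` in degree `d` to `x s ^ d`. -/
def gradingHom : QuantumExterior v q →ₐ[K] (QuantumExterior v q)[X] :=
  lift (((Polynomial.monomial 1).restrictScalars K) ∘ₗ ι v q)
    (fun i j hij => by
      simp only [LinearMap.comp_apply, LinearMap.restrictScalars_apply,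
        Polynomial.monomial_mul_monomial, ι_mul_ι v q hij, Polynomial.smul_monomial])
    (fun i => by
      simp only [LinearMap.comp_apply, LinearMap.restrictScalars_apply,
        Polynomial.monomial_mul_monomial, ι_mul_self, map_zero])

variable {v q}

theorem gradingHom_of_mem_pow {p : ℕ} {a : QuantumExterior v q}
    (ha : a ∈ LinearMap.range (ι v q) ^ p) : gradingHom v q a = Polynomial.monomial p a := by
  induction ha using Submodule.pow_induction_on_left' with
  | algebraMap r => rw [AlgHom.commutes]; rfl
  | add x y i _ _ hx hy => rw [map_add, hx, hy, map_add]
  | mem_mul m hm i x _ hx =>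
    obtain ⟨y, rfl⟩ := hm
    rw [map_mul, hx, gradingHom, lift_ι, Nat.succ_eq_one_add]
    exact Polynomial.monomial_mul_monomial _ _ _ _

/-- `gradingHom` separates degrees, so the coordinate at `α` is already visible in the part of
degree `monomialDegree α`. For a homogeneous element this kills all coordinates in other degrees. -/
theorem basis_repr_coeff_gradingHom (hqq : ∀ i j, i ≠ j → q i j * q j i = 1)
    (a : QuantumExterior v q) (α : Fin n → Fin 2) :
    (basis v hqq).repr ((gradingHom v q a).coeff (monomialDegree α)) α =
      (basis v hqq).repr a α := by
  have : ((basis v hqq).coord α ∘ₗ ((Polynomial.lcoeff (QuantumExterior v q)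
      (monomialDegree α)).restrictScalars K) ∘ₗ (gradingHom v q).toLinearMap) =
      (basis v hqq).coord α := by
    refine (basis v hqq).ext fun β => ?_
    have h := gradingHom_of_mem_pow (monomial_mem_pow v q β)
    rw [← basis_apply v hqq] at h
    simp only [LinearMap.comp_apply, AlgHom.toLinearMap_apply, h, LinearMap.restrictScalars_apply,
      Polynomial.lcoeff_apply, Polynomial.coeff_monomial, Module.Basis.coord_apply]
    split_ifs with hβ
    · rfl
    · rw [map_zero, Module.Basis.repr_self, Finsupp.single_apply, if_neg]
      · rfl
      · rintro rfl; exact hβ rfl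
  exact LinearMap.congr_fun this a

theorem monomialDegree_eq_of_repr_ne_zero (hqq : ∀ i j, i ≠ j → q i j * q j i = 1) {p : ℕ}
    {a : QuantumExterior v q} (ha : a ∈ LinearMap.range (ι v q) ^ p) {α : Fin n → Fin 2}
    (h : (basis v hqq).repr a α ≠ 0) : monomialDegree α = p := by
  rw [← basis_repr_coeff_gradingHom, gradingHom_of_mem_pow ha, Polynomial.coeff_monomial] at h
  by_contra hne
  rw [if_neg (Ne.symm hne)] at h
  simp at h

end QuantumExterior

/-! ### Monomial basis and degrees of `Λ_q(V) ⋊ G`. -/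

variable {v q} {G : Subgroup (V ≃ₗ[K] V)}
  (ρ : G →* (QuantumExterior v q ≃ₐ[K] QuantumExterior v q))

/-- The basis `v_1^{α_1} ⋯ v_n^{α_n} g` of `Λ_q(V) ⋊ G`. -/
def skewBasis (hqq : ∀ i j, i ≠ j → q i j * q j i = 1) :
    Module.Basis ((Fin n → Fin 2) × G) K (SkewGroupAlgebra ρ) :=
  SkewGroupAlgebra.basis ρ (QuantumExterior.basis v hqq)

theorem skewBasis_apply (hqq : ∀ i j, i ≠ j → q i j * q j i = 1) (k : (Fin n → Fin 2) × G) :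
    skewBasis ρ hqq k = SkewGroupAlgebra.mon ρ (QuantumExterior.monomial v q k.1) k.2 := by
  rw [skewBasis, SkewGroupAlgebra.basis_apply, QuantumExterior.basis_apply]

theorem skewBasis_mem_skewDegree (hqq : ∀ i j, i ≠ j → q i j * q j i = 1)
    (k : (Fin n → Fin 2) × G) : skewBasis ρ hqq k ∈ skewDegree ρ (monomialDegree k.1) :=
  Submodule.subset_span ⟨_, rfl, _, QuantumExterior.monomial_mem_pow v q k.1, k.2,
    skewBasis_apply ρ hqq k⟩

theorem mem_skewDegree_iff (hqq : ∀ i j, i ≠ j → q i j * q j i = 1) {d : ℤ}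
    {x : SkewGroupAlgebra ρ} :
    x ∈ skewDegree ρ d ↔ ∀ k, (skewBasis ρ hqq).repr x k ≠ 0 → (monomialDegree k.1 : ℤ) = d := by
  constructor
  · intro hx
    induction hx using Submodule.span_induction with
    | mem x hx =>
      obtain ⟨p, rfl, a, ha, g, rfl⟩ := hx
      classical
      rintro ⟨α, h⟩ hne
      rw [skewBasis, SkewGroupAlgebra.basis_repr_mon, Finsupp.single_apply] at hne
      split_ifs at hne with hg
      · exact_mod_cast QuantumExterior.monomialDegree_eq_of_repr_ne_zero hqq ha hne
      · exact absurd rfl hne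
    | zero => simp
    | add x y _ _ hx hy =>
      intro k hk
      by_cases hxk : (skewBasis ρ hqq).repr x k = 0
      · refine hy k fun hyk => hk ?_
        rw [map_add, Finsupp.add_apply, hxk, hyk, add_zero]
      · exact hx k hxk
    | smul c x _ hx =>
      intro k hk
      refine hx k fun hxk => hk ?_
      rw [map_smul, Finsupp.smul_apply, hxk, smul_zero]
  · intro h
    rw [← (skewBasis ρ hqq).linearCombination_repr x, Finsupp.linearCombination_apply]
    refine Submodule.sum_mem _ fun k hk => Submodule.smul_mem _ _ ?_
    rw [← h k (Finsupp.mem_support_iff.1 hk)]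
    exact skewBasis_mem_skewDegree ρ hqq k

end TruncatedQDH

/-! ### The Hecke algebra: relations and spanning monomials. -/

namespace TruncatedQDH

section HeckeAlgebra

attribute [local instance] Polynomial.algebra

variable {K : Type*} [Field K] {n : ℕ} {V : Type*} [AddCommGroup V] [Module K V]
  (v : Module.Basis (Fin n) K V) (q : Fin n → Fin n → K) {G : Subgroup (V ≃ₗ[K] V)}
  (κ : V →ₗ[K] V →ₗ[K] MonoidAlgebra K G)

instance HeckeAlgebra.instAlgebraBase : Algebra K (HeckeAlgebra v q κ) :=
  Algebra.compHom _ (C : K →+* K[X])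

theorem HeckeAlgebra.algebraMap_base (c : K) :
    algebraMap K (HeckeAlgebra v q κ) c = algebraMap K[X] (HeckeAlgebra v q κ) (C c) := rfl

theorem HeckeAlgebra.smul_base (c : K) (x : HeckeAlgebra v q κ) : c • x = (C c : K[X]) • x := rfl

/-- The map `T(V) ⋊ G → Ĥ_{q,κ,t}`. -/
def HeckeAlgebra.ofTensorSkew : TensorSkew G →ₐ[K] HeckeAlgebra v q κ where
  __ := (HeckeAlgebra.mk v q κ : (TensorSkew G)[X] →+* HeckeAlgebra v q κ).comp C
  commutes' c := by
    rw [HeckeAlgebra.algebraMap_base, ← (HeckeAlgebra.mk v q κ).commutes]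
    simp [Polynomial.algebraMap_def]

theorem HeckeAlgebra.ofTensorSkew_apply (x : TensorSkew G) :
    HeckeAlgebra.ofTensorSkew v q κ x = HeckeAlgebra.mk v q κ (C x) := rfl

/-- The linear map `V → Ĥ_{q,κ,t}`. -/
def heckeι : V →ₗ[K] HeckeAlgebra v q κ :=
  (HeckeAlgebra.ofTensorSkew v q κ).toLinearMap ∘ₗ
    (SkewGroupAlgebra.ofBase (tensorAction G)).toLinearMap ∘ₗ TensorAlgebra.ι K

/-- The group homomorphism `G → Ĥ_{q,κ,t}`. -/
def heckeGroupHom : G →* HeckeAlgebra v q κ :=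
  ((HeckeAlgebra.ofTensorSkew v q κ : TensorSkew G →* HeckeAlgebra v q κ)).comp
    (SkewGroupAlgebra.ofGroup (tensorAction G))

theorem heckeι_basis (i : Fin n) : heckeι v q κ (v i) = heckeGen v q κ i := rfl

theorem heckeGroupHom_apply (g : G) : heckeGroupHom v q κ g = heckeGroup v q κ g := rfl

theorem tensorAction_ι (g : G) (x : V) :
    tensorAction G g (TensorAlgebra.ι K x) = TensorAlgebra.ι K ((g : V ≃ₗ[K] V) x) :=
  TensorAlgebra.lift_ι_apply _ _

theorem heckeGroupHom_mul_heckeι (g : G) (x : V) :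
    heckeGroupHom v q κ g * heckeι v q κ x =
      heckeι v q κ ((g : V ≃ₗ[K] V) x) * heckeGroupHom v q κ g := by
  change HeckeAlgebra.ofTensorSkew v q κ _ * HeckeAlgebra.ofTensorSkew v q κ _ =
    HeckeAlgebra.ofTensorSkew v q κ _ * HeckeAlgebra.ofTensorSkew v q κ _
  rw [← map_mul, ← map_mul]
  congr 1
  exact (SkewGroupAlgebra.ofGroup_mul_ofBase _ _ _).trans (by rw [tensorAction_ι]; rfl)

theorem ofTensorSkew_ofGroupAlgebra (y : MonoidAlgebra K G) :
    HeckeAlgebra.ofTensorSkew v q κ (SkewGroupAlgebra.ofGroupAlgebra (tensorAction G) y) =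
      MonoidAlgebra.lift K (HeckeAlgebra v q κ) G (heckeGroupHom v q κ) y := by
  have : (HeckeAlgebra.ofTensorSkew v q κ).comp
      (SkewGroupAlgebra.ofGroupAlgebra (tensorAction G)) =
      MonoidAlgebra.lift K (HeckeAlgebra v q κ) G (heckeGroupHom v q κ) := by
    ext g
    simp [SkewGroupAlgebra.ofGroupAlgebra, heckeGroupHom]
  exact DFunLike.congr_fun this y

theorem heckeGen_mul_heckeGen (i j : Fin n) :
    heckeGen v q κ j * heckeGen v q κ i = q i j • (heckeGen v q κ i * heckeGen v q κ j) +
      (X : K[X]) • MonoidAlgebra.lift K (HeckeAlgebra v q κ) G (heckeGroupHom v q κ)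
        (κ (v i) (v j)) := by
  have h : HeckeAlgebra.mk v q κ _ = HeckeAlgebra.mk v q κ _ :=
    RingQuot.mkAlgHom_rel K[X] (HeckeRel.comm i j)
  have hX : HeckeAlgebra.mk v q κ X = algebraMap K[X] (HeckeAlgebra v q κ) X := by
    rw [← (HeckeAlgebra.mk v q κ).commutes]
    simp [Polynomial.algebraMap_def]
  rw [map_add, map_mul _ _ X, hX, ← Algebra.commutes, ← Algebra.smul_def] at h
  simp only [← HeckeAlgebra.ofTensorSkew_apply, map_mul, map_smul,
    ofTensorSkew_ofGroupAlgebra] at h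
  exact h

theorem heckeGen_mul_self (i : Fin n) : heckeGen v q κ i * heckeGen v q κ i = 0 := by
  have h : HeckeAlgebra.mk v q κ _ = HeckeAlgebra.mk v q κ _ :=
    RingQuot.mkAlgHom_rel K[X] (HeckeRel.sq i)
  rwa [← HeckeAlgebra.ofTensorSkew_apply, map_pow, map_zero, pow_two] at h

theorem adjoin_heckeGen_heckeGroup :
    Algebra.adjoin K[X] (Set.range (heckeGen v q κ) ∪ Set.range (heckeGroupHom v q κ)) = ⊤ := by
  set S := Algebra.adjoin K[X]
    (Set.range (heckeGen v q κ) ∪ Set.range (heckeGroupHom v q κ)) with hS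
  have hbase : ∀ c : K, algebraMap K (HeckeAlgebra v q κ) c ∈ S := fun c =>
    Subalgebra.algebraMap_mem S (C c)
  have hgen : ∀ i, heckeι v q κ (v i) ∈ S := fun i =>
    Algebra.subset_adjoin (Set.mem_union_left _ (Set.mem_range_self i))
  have hι : ∀ x, heckeι v q κ x ∈ S := by
    intro x
    rw [← v.sum_repr x, map_sum]
    refine Subalgebra.sum_mem _ fun i _ => ?_
    rw [map_smul, HeckeAlgebra.smul_base]
    exact Subalgebra.smul_mem _ (hgen i) _
  have htens : ∀ a, HeckeAlgebra.ofTensorSkew v q κ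
      (SkewGroupAlgebra.ofBase (tensorAction G) a) ∈ S := by
    intro a
    induction a using TensorAlgebra.induction with
    | algebraMap r => rw [AlgHom.commutes, AlgHom.commutes]; exact hbase r
    | ι x => exact hι x
    | mul a b ha hb => rw [map_mul, map_mul]; exact mul_mem ha hb
    | add a b ha hb => rw [map_add, map_add]; exact add_mem ha hb
  have hskew : ∀ x, HeckeAlgebra.ofTensorSkew v q κ x ∈ S := by
    intro x
    induction x using SkewGroupAlgebra.induction_on with
    | hmon a g =>
      rw [SkewGroupAlgebra.mon_eq_mul, map_mul]
      exact mul_mem (htens a) (Algebra.subset_adjoin (Or.inr ⟨g, rfl⟩))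
    | hadd x y hx hy => rw [map_add]; exact add_mem hx hy
  rw [eq_top_iff]
  rintro x -
  obtain ⟨p, rfl⟩ := RingQuot.mkAlgHom_surjective K[X] _ x
  change HeckeAlgebra.mk v q κ p ∈ S
  induction p using Polynomial.induction_on' with
  | add p r hp hr => rw [map_add]; exact add_mem hp hr
  | monomial m a =>
    have hX : HeckeAlgebra.mk v q κ X = algebraMap K[X] (HeckeAlgebra v q κ) X := by
      rw [← (HeckeAlgebra.mk v q κ).commutes]
      simp [Polynomial.algebraMap_def]
    rw [← C_mul_X_pow_eq_monomial, map_mul, map_pow, hX]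
    exact mul_mem (hskew a) (pow_mem (Subalgebra.algebraMap_mem _ _) m)

theorem pbwMonomial_eq :
    pbwMonomial v q κ = orderedMonomial (heckeGen v q κ) (heckeGroupHom v q κ) := rfl

theorem lift_heckeGroupHom_mem_span (y : MonoidAlgebra K G) :
    MonoidAlgebra.lift K (HeckeAlgebra v q κ) G (heckeGroupHom v q κ) y ∈
      Submodule.span K[X] (Set.range (heckeGroupHom v q κ)) := by
  induction y using MonoidAlgebra.induction_on with
  | of g =>
    rw [MonoidAlgebra.lift_of]
    exact Submodule.subset_span ⟨g, rfl⟩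
  | add a b ha hb => rw [map_add]; exact add_mem ha hb
  | smul c a ha => rw [map_smul, HeckeAlgebra.smul_base]; exact Submodule.smul_mem _ _ ha

/-- Straightening applies for every `κ`, because the commutation error `t κ(v_i, v_j)` contains no
letters. The PBW property is therefore only a matter of independence. -/
theorem span_pbwMonomial : Submodule.span K[X] (Set.range (pbwMonomial v q κ)) = ⊤ := by
  rw [pbwMonomial_eq]
  refine span_orderedMonomial_eq_top (k := K[X]) (q := fun i j => C (q i j)) ?_ ?_
    (heckeGen_mul_self v q κ) (adjoin_heckeGen_heckeGroup v q κ)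
  · intro g i
    rw [← heckeι_basis, heckeGroupHom_mul_heckeι, ← v.sum_repr ((g : V ≃ₗ[K] V) (v i)), map_sum,
      Finset.sum_mul]
    refine Submodule.sum_mem _ fun j _ => ?_
    rw [map_smul, HeckeAlgebra.smul_base, smul_mul_assoc]
    exact Submodule.smul_mem _ _ (Submodule.subset_span ⟨j, rfl⟩)
  · intro i j _
    rw [heckeGen_mul_heckeGen v q κ i j, HeckeAlgebra.smul_base, add_sub_cancel_left]
    exact Submodule.smul_mem _ _ (lift_heckeGroupHom_mem_span v q κ _)

/-! #### The universal property -/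

variable {v q κ} {B : Type*} [Ring B] [Algebra K B] (f : V →ₗ[K] B) (w : G →* B) (τ : B)

theorem mul_tensorLift (hwf : ∀ (g : G) x, w g * f x = f ((g : V ≃ₗ[K] V) x) * w g) (g : G)
    (a : TensorAlgebra K V) :
    w g * TensorAlgebra.lift K f a = TensorAlgebra.lift K f (tensorAction G g a) * w g := by
  induction a using TensorAlgebra.induction with
  | algebraMap r => simpa only [AlgHom.commutes, AlgEquiv.commutes] using (Algebra.commutes r _).symm
  | ι x => simpa only [tensorAction_ι, TensorAlgebra.lift_ι_apply] using hwf g x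
  | mul a b ha hb => rw [map_mul, map_mul, map_mul, ← mul_assoc, ha, mul_assoc, hb, mul_assoc]
  | add a b ha hb => rw [map_add, map_add, map_add, mul_add, ha, hb, add_mul]

/-- The universal property of `T(V) ⋊ G`. -/
def tensorSkewLift (hwf : ∀ (g : G) x, w g * f x = f ((g : V ≃ₗ[K] V) x) * w g) :
    TensorSkew G →ₐ[K] B :=
  SkewGroupAlgebra.lift (tensorAction G) (TensorAlgebra.lift K f) w (mul_tensorLift f w hwf)

theorem tensorSkewLift_gen (hwf : ∀ (g : G) x, w g * f x = f ((g : V ≃ₗ[K] V) x) * w g)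
    (i : Fin n) : tensorSkewLift f w hwf (tensorGen v G i) = f (v i) := by
  simp [tensorSkewLift, tensorGen, SkewGroupAlgebra.lift_mon]

theorem tensorSkewLift_ofGroup (hwf : ∀ (g : G) x, w g * f x = f ((g : V ≃ₗ[K] V) x) * w g)
    (g : G) : tensorSkewLift f w hwf (SkewGroupAlgebra.ofGroup (tensorAction G) g) = w g := by
  simp [tensorSkewLift, SkewGroupAlgebra.ofGroup_apply, SkewGroupAlgebra.lift_mon]

theorem tensorSkewLift_ofGroupAlgebra
    (hwf : ∀ (g : G) x, w g * f x = f ((g : V ≃ₗ[K] V) x) * w g) (y : MonoidAlgebra K G) :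
    tensorSkewLift f w hwf (SkewGroupAlgebra.ofGroupAlgebra (tensorAction G) y) =
      MonoidAlgebra.lift K B G w y := by
  have : (tensorSkewLift f w hwf).comp (SkewGroupAlgebra.ofGroupAlgebra (tensorAction G)) =
      MonoidAlgebra.lift K B G w := by
    ext g
    simp [SkewGroupAlgebra.ofGroupAlgebra, tensorSkewLift_ofGroup]
  exact DFunLike.congr_fun this y

/-- The universal property of `Ĥ_{q,κ,t}`, where `t` may be sent to any central element `τ`. -/
def heckeLift (hwf : ∀ (g : G) x, w g * f x = f ((g : V ≃ₗ[K] V) x) * w g)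
    (hτ : ∀ b, Commute b τ)
    (hrel : ∀ i j, f (v j) * f (v i) =
      q i j • (f (v i) * f (v j)) + MonoidAlgebra.lift K B G w (κ (v i) (v j)) * τ)
    (hsq : ∀ i, f (v i) * f (v i) = 0) : HeckeAlgebra v q κ →+* B :=
  RingQuot.lift ⟨Polynomial.eval₂RingHom' (tensorSkewLift f w hwf : TensorSkew G →+* B) τ
    fun _ => hτ _, fun x y hxy => by
      cases hxy with
      | comm i j =>
        change eval₂ _ _ _ = eval₂ _ _ _
        rw [eval₂_C, eval₂_add, eval₂_C, eval₂_mul_X, eval₂_C]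
        simpa [tensorSkewLift_gen, tensorSkewLift_ofGroupAlgebra] using hrel i j
      | sq i =>
        change eval₂ _ _ _ = eval₂ _ _ _
        rw [eval₂_C, eval₂_zero]
        simpa [tensorSkewLift_gen, pow_two] using hsq i⟩

section

variable {f w τ} (hwf : ∀ (g : G) x, w g * f x = f ((g : V ≃ₗ[K] V) x) * w g)
    (hτ : ∀ b, Commute b τ)
    (hrel : ∀ i j, f (v j) * f (v i) =
      q i j • (f (v i) * f (v j)) + MonoidAlgebra.lift K B G w (κ (v i) (v j)) * τ)
    (hsq : ∀ i, f (v i) * f (v i) = 0)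

theorem heckeLift_mk (p : (TensorSkew G)[X]) :
    heckeLift f w τ hwf hτ hrel hsq (HeckeAlgebra.mk v q κ p) =
      p.eval₂ (tensorSkewLift f w hwf : TensorSkew G →+* B) τ := by
  have h : HeckeAlgebra.mk v q κ p = RingQuot.mkRingHom (HeckeRel v q κ) p :=
    DFunLike.congr_fun (RingQuot.mkAlgHom_coe K[X] (HeckeRel v q κ)) p
  rw [h]
  exact RingQuot.lift_mkRingHom_apply _ _ _

theorem heckeLift_heckeGen (i : Fin n) :
    heckeLift f w τ hwf hτ hrel hsq (heckeGen v q κ i) = f (v i) := by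
  rw [heckeGen, heckeLift_mk, eval₂_C]
  exact tensorSkewLift_gen f w hwf i

theorem heckeLift_heckeGroup (g : G) :
    heckeLift f w τ hwf hτ hrel hsq (heckeGroup v q κ g) = w g := by
  rw [heckeGroup, heckeLift_mk, eval₂_C]
  exact tensorSkewLift_ofGroup f w hwf g

/-- The target is only a `K`-algebra, so `K[t]` acts on it through evaluation at `τ`. The cases used
are `τ = 0`, `τ = t s²` and `τ = t`. -/
theorem heckeLift_smul (p : K[X]) (x : HeckeAlgebra v q κ) :
    heckeLift f w τ hwf hτ hrel hsq (p • x) =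
      aeval τ p * heckeLift f w τ hwf hτ hrel hsq x := by
  rw [Algebra.smul_def, map_mul, ← (HeckeAlgebra.mk v q κ).commutes, heckeLift_mk,
    Polynomial.algebraMap_def, coe_mapRingHom, eval₂_map, aeval_def]
  congr 2
  ext c
  simp

theorem heckeLift_pbwMonomial (k : (Fin n → Fin 2) × G) :
    heckeLift f w τ hwf hτ hrel hsq (pbwMonomial v q κ k) =
      (List.ofFn fun i => f (v i) ^ (k.1 i : ℕ)).prod * w k.2 := by
  rw [pbwMonomial, map_mul, heckeLift_heckeGroup, map_list_prod, List.map_ofFn]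
  simp only [Function.comp_def, map_pow, heckeLift_heckeGen]

end

end HeckeAlgebra

end TruncatedQDH

/-! ### Bases of `A[t]` over `K[t]`. -/

section PolynomialBasis

attribute [local instance] Polynomial.algebra

variable {K : Type*} [Field K] {A : Type*} [Ring A] [Algebra K A]

theorem coeff_smul_C (p : K[X]) (a : A) (m : ℕ) : (p • (C a : A[X])).coeff m = p.coeff m • a := by
  rw [Algebra.smul_def, Polynomial.algebraMap_def, coe_mapRingHom, coeff_mul_C, coeff_map,
    ← Algebra.smul_def]

theorem monomial_one_smul_C (a : A) (m : ℕ) :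
    (Polynomial.monomial m (1 : K)) • (C a : A[X]) = Polynomial.monomial m a := by
  ext i
  rw [coeff_smul_C, coeff_monomial, coeff_monomial]
  split_ifs <;> simp

theorem Module.Basis.polynomial_induction {ι M : Type*} [AddCommGroup M] [Module K[X] M]
    (b : Module.Basis ι K[X] M) {P : M → Prop} (zero : P 0) (add : ∀ x y, P x → P y → P (x + y))
    (monomial_smul : ∀ i m (c : K), P (Polynomial.monomial m c • b i)) (x : M) : P x := by
  obtain ⟨f, rfl⟩ := b.repr.symm.surjective x
  induction f using Finsupp.induction_linear with
  | zero => simpa using zero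
  | add f g hf hg => rw [map_add]; exact add _ _ hf hg
  | single i p =>
    rw [Module.Basis.repr_symm_single]
    induction p using Polynomial.induction_on' with
    | add p r hp hr => rw [add_smul]; exact add _ _ hp hr
    | monomial m c => exact monomial_smul i m c

/-- A `K`-basis of `A` is a `K[t]`-basis of `A[t]`. -/
def polynomialBasis {ι : Type*} (b : Module.Basis ι K A) : Module.Basis ι K[X] A[X] :=
  Module.Basis.mk (v := fun i => C (b i))
    (by
      rw [linearIndependent_iff']
      intro s g hg i hi
      ext m
      have h := congrArg (fun f : A[X] => f.coeff m) hg
      simp only [finsetSum_coeff, coeff_smul_C, coeff_zero] at h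
      exact linearIndependent_iff'.1 b.linearIndependent s _ h i hi)
    (by
      rintro f -
      induction f using Polynomial.induction_on' with
      | add f g hf hg => exact add_mem hf hg
      | monomial m a =>
        rw [← monomial_one_smul_C (K := K)]
        refine Submodule.smul_mem _ _ ?_
        rw [← b.linearCombination_repr a, Finsupp.linearCombination_apply, Finsupp.sum, map_sum]
        refine Submodule.sum_mem _ fun i _ => ?_
        rw [Deformation.C_smul_eq]
        exact Submodule.smul_mem _ _ (Submodule.subset_span ⟨i, rfl⟩))

theorem polynomialBasis_apply {ι : Type*} (b : Module.Basis ι K A) (i : ι) :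
    polynomialBasis b i = C (b i) := by
  simp [polynomialBasis]

theorem repr_coeff_eq_coeff_repr {ι : Type*} (b : Module.Basis ι K A) (f : A[X]) (m : ℕ) (i : ι) :
    b.repr (f.coeff m) i = ((polynomialBasis b).repr f i).coeff m := by
  induction f using Module.Basis.polynomial_induction (polynomialBasis b) with
  | zero => simp
  | add f g hf hg => simp only [coeff_add, map_add, Finsupp.add_apply, hf, hg]
  | monomial_smul j l c =>
    classical
    rw [polynomialBasis_apply, coeff_smul_C, ← polynomialBasis_apply, map_smul, map_smul,
      Module.Basis.repr_self, Module.Basis.repr_self, Finsupp.smul_apply, Finsupp.smul_apply,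
      Finsupp.single_apply, Finsupp.single_apply]
    split_ifs <;> simp

end PolynomialBasis

section SortedWords

variable {R : Type*} [Ring R] {n : ℕ} (x : Fin n → R)

/-- A strictly increasing list is determined by its set of letters. This recognises `v_i`, and `v_i
v_j` with `i < j`, as ordered monomials. -/
theorem prod_map_eq_of_pairwise_lt {l : List (Fin n)} (hl : l.Pairwise (· < ·)) :
    (l.map x).prod =
      (List.ofFn fun i => x i ^ ((if i ∈ l then 1 else 0 : Fin 2) : ℕ)).prod := by
  rw [prod_ofFn_pow_eq]
  congr 2
  refine List.Perm.eq_of_pairwise (le := (· < ·)) (fun a b _ _ h h' => (lt_asymm h h').elim) hl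
    ((List.pairwise_lt_finRange n).filter _) ?_
  rw [List.perm_ext_iff_of_nodup (hl.imp fun h => h.ne) ((List.nodup_finRange n).filter _)]
  simp

end SortedWords

namespace TruncatedQDH

attribute [local instance] Polynomial.algebra

variable {K : Type*} [Field K] {n : ℕ} {V : Type*} [AddCommGroup V] [Module K V]
  {v : Module.Basis (Fin n) K V} {q : Fin n → Fin n → K} {G : Subgroup (V ≃ₗ[K] V)}

/-- The exponents `(1, 0)` of a single generator. -/
def genIndex (i : Fin n) : Fin n → Fin 2 := fun a => if a ∈ [i] then 1 else 0

theorem extGen_eq_skewBasis (ρ : G →* (QuantumExterior v q ≃ₐ[K] QuantumExterior v q))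
    (hqq : ∀ i j, i ≠ j → q i j * q j i = 1) (i : Fin n) :
    extGen ρ i = skewBasis ρ hqq (genIndex i, 1) := by
  rw [skewBasis_apply, QuantumExterior.monomial, extGen]
  unfold genIndex
  rw [← prod_map_eq_of_pairwise_lt _ (List.pairwise_singleton _ _)]
  simp

theorem ofGroup_eq_skewBasis (ρ : G →* (QuantumExterior v q ≃ₐ[K] QuantumExterior v q))
    (hqq : ∀ i j, i ≠ j → q i j * q j i = 1) (g : G) :
    SkewGroupAlgebra.ofGroup ρ g = skewBasis ρ hqq (0, g) := by
  rw [skewBasis_apply, QuantumExterior.monomial, SkewGroupAlgebra.ofGroup_apply]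
  simp

variable (κ : V →ₗ[K] V →ₗ[K] MonoidAlgebra K G)

theorem heckeGen_eq_pbwMonomial (i : Fin n) :
    heckeGen v q κ i = pbwMonomial v q κ (genIndex i, 1) := by
  rw [pbwMonomial, ← heckeGroupHom_apply]
  unfold genIndex
  rw [← prod_map_eq_of_pairwise_lt _ (List.pairwise_singleton _ _)]
  simp

theorem heckeGroup_eq_pbwMonomial (g : G) : heckeGroup v q κ g = pbwMonomial v q κ (0, g) := by
  simp [pbwMonomial]

/-! ### From a PBW basis to a deformation -/

namespace IsTruncatedQDH

variable {κ} (h : IsTruncatedQDH v q κ)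
include h

/-- The PBW basis. -/
def basis : Module.Basis ((Fin n → Fin 2) × G) K[X] (HeckeAlgebra v q κ) :=
  Module.Basis.mk h.1 h.2.ge

theorem basis_apply (k : (Fin n → Fin 2) × G) : h.basis k = pbwMonomial v q κ k := by
  simp [basis]

/-- Group elements are the PBW monomials with exponent `0`, so the terms `t κ(v_i, v_j)` are
invisible at all other exponents. -/
theorem repr_eq_zero_of_mem_span_group {y : HeckeAlgebra v q κ}
    (hy : y ∈ Submodule.span K[X] (Set.range (heckeGroupHom v q κ))) {k : (Fin n → Fin 2) × G}
    (hk : k.1 ≠ 0) : h.basis.repr y k = 0 := by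
  induction hy using Submodule.span_induction with
  | mem y hy =>
    classical
    obtain ⟨g, rfl⟩ := hy
    rw [heckeGroupHom_apply, heckeGroup_eq_pbwMonomial, ← h.basis_apply,
      Module.Basis.repr_self_apply, if_neg]
    rintro rfl
    exact hk rfl
  | zero => simp
  | add y z _ _ hy hz => rw [map_add, Finsupp.add_apply, hy, hz, add_zero]
  | smul c y _ hy => rw [map_smul, Finsupp.smul_apply, hy, smul_zero]

/-- Commuting `v_i v_j` twice returns `q_{ij} q_{ji} v_i v_j` plus terms in the span of `G`; compare
coefficients at the PBW monomial `v_i v_j`. -/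
theorem mul_eq_one_of_lt {i j : Fin n} (hij : i < j) : q i j * q j i = 1 := by
  let α : Fin n → Fin 2 := fun a => if a ∈ [i, j] then 1 else 0
  have hα : heckeGen v q κ i * heckeGen v q κ j = h.basis (α, 1) := by
    rw [h.basis_apply, pbwMonomial, ← heckeGroupHom_apply,
      ← prod_map_eq_of_pairwise_lt (heckeGen v q κ) (l := [i, j]) (by simpa using hij)]
    simp
  have hα0 : α ≠ 0 := fun h0 => by simpa [α] using congrFun h0 i
  have h1 := heckeGen_mul_heckeGen v q κ j i
  rw [heckeGen_mul_heckeGen v q κ i j, hα] at h1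
  have h2 := congrArg (fun y => h.basis.repr y (α, 1)) h1
  simp only [map_add, HeckeAlgebra.smul_base, map_smul, Finsupp.add_apply, Finsupp.smul_apply,
    smul_eq_mul, smul_add, Module.Basis.repr_self, Finsupp.single_eq_same,
    h.repr_eq_zero_of_mem_span_group (lift_heckeGroupHom_mem_span v q κ _) (k := (α, 1)) hα0,
    mul_zero, add_zero, mul_one, ← C_mul, ← C_1] at h2
  rw [mul_comm, ← C_injective h2]

theorem mul_eq_one {i j : Fin n} (hij : i ≠ j) : q i j * q j i = 1 := by
  rcases lt_or_gt_of_ne hij with h' | h'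
  · exact h.mul_eq_one_of_lt h'
  · rw [mul_comm]
    exact h.mul_eq_one_of_lt h'

end IsTruncatedQDH

/-! ### Specialization at `t = 0` and the action on `Λ_q(V)`. -/

section Specialization

variable (v q)

/-- The ideal `t Ĥ_{q,κ,t}`. -/
def tIdeal : Ideal (HeckeAlgebra v q κ) where
  carrier := {y | ∃ z, y = (X : K[X]) • z}
  zero_mem' := ⟨0, by simp⟩
  add_mem' := by
    rintro _ _ ⟨a, rfl⟩ ⟨b, rfl⟩
    exact ⟨a + b, by simp⟩
  smul_mem' := by
    rintro c _ ⟨a, rfl⟩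
    exact ⟨c * a, by simp⟩

instance tIdeal_isTwoSided : (tIdeal v q κ).IsTwoSided :=
  ⟨by
    rintro _ b ⟨a, rfl⟩
    exact ⟨a * b, by simp⟩⟩

theorem mem_tIdeal {y : HeckeAlgebra v q κ} : y ∈ tIdeal v q κ ↔ ∃ z, y = (X : K[X]) • z :=
  Iff.rfl

/-- The specialization of `Ĥ_{q,κ,t}` at `t = 0`. -/
abbrev HeckeSpecialization : Type _ := HeckeAlgebra v q κ ⧸ tIdeal v q κ

/-- The quotient map to the specialization at `t = 0`. -/
abbrev specialize : HeckeAlgebra v q κ →ₐ[K] HeckeSpecialization v q κ :=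
  Ideal.Quotient.mkₐ K (tIdeal v q κ)

/-- The map from `Λ_q(V)` to the specialization of `Ĥ_{q,κ,t}` at `t = 0`. -/
def extToSpecialization : QuantumExterior v q →ₐ[K] HeckeSpecialization v q κ :=
  QuantumExterior.lift ((specialize v q κ).toLinearMap ∘ₗ heckeι v q κ)
    (fun i j _ => by
      simp only [LinearMap.comp_apply, AlgHom.toLinearMap_apply, heckeι_basis, ← map_mul,
        ← map_smul]
      rw [Ideal.Quotient.mkₐ_eq_mk, Ideal.Quotient.eq]
      exact ⟨_, by rw [heckeGen_mul_heckeGen, add_sub_cancel_left]⟩)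
    (fun i => by
      simp only [LinearMap.comp_apply, AlgHom.toLinearMap_apply, heckeι_basis, ← map_mul,
        heckeGen_mul_self, map_zero])

theorem extToSpecialization_ι (x : V) :
    extToSpecialization v q κ (QuantumExterior.ι v q x) = specialize v q κ (heckeι v q κ x) :=
  QuantumExterior.lift_ι _ _ _ _ _ _

theorem extToSpecialization_monomial (α : Fin n → Fin 2) :
    extToSpecialization v q κ (QuantumExterior.monomial v q α) =
      specialize v q κ (pbwMonomial v q κ (α, 1)) := by
  rw [QuantumExterior.monomial, pbwMonomial, ← heckeGroupHom_apply, map_one, mul_one,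
    map_list_prod, map_list_prod, List.map_ofFn, List.map_ofFn]
  simp only [Function.comp_def, map_pow, extToSpecialization_ι, heckeι_basis]

variable {v q κ}

/-- A relation modulo `t` says that a `K`-combination of PBW monomials equals `t z`; its
coefficients are constants divisible by `t`, hence zero. -/
theorem IsTruncatedQDH.linearIndependent_specialize (h : IsTruncatedQDH v q κ) :
    LinearIndependent K fun k => specialize v q κ (pbwMonomial v q κ k) := by
  rw [linearIndependent_iff']
  intro s c hc k hk
  simp only [← map_smul, ← map_sum] at hc
  rw [Ideal.Quotient.mkₐ_eq_mk, Ideal.Quotient.eq_zero_iff_mem, mem_tIdeal] at hc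
  obtain ⟨z, hz⟩ := hc
  have h1 := congrArg (fun y => (h.basis.repr y k).coeff 0) hz
  simp only [HeckeAlgebra.smul_base, ← h.basis_apply, map_sum, map_smul, Finsupp.smul_apply,
    Finsupp.finsetSum_apply, Module.Basis.repr_self, smul_eq_mul, mul_coeff_zero, coeff_X_zero,
    zero_mul, finsetSum_coeff, coeff_C_zero] at h1
  classical
  rw [Finset.sum_eq_single k] at h1
  · simpa using h1
  · intro b _ hb
    rw [Finsupp.single_apply, if_neg hb]
    simp
  · exact fun hn => (hn hk).elim

theorem IsTruncatedQDH.extToSpecialization_injective (h : IsTruncatedQDH v q κ) :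
    Function.Injective (extToSpecialization v q κ) := by
  have hqq : ∀ i j, i ≠ j → q i j * q j i = 1 := fun _ _ => h.mul_eq_one
  have h1 : LinearIndependent K fun α : Fin n → Fin 2 =>
      specialize v q κ (pbwMonomial v q κ (α, 1)) :=
    h.linearIndependent_specialize.comp (fun α => (α, 1)) fun _ _ h => (Prod.ext_iff.1 h).1
  have h2 := (QuantumExterior.basis v hqq).injective_constr_of_linearIndependent (R₂ := K) h1
  convert h2 using 1
  have h3 : (extToSpecialization v q κ).toLinearMap =
      (QuantumExterior.basis v hqq).constr K fun α : Fin n → Fin 2 =>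
        specialize v q κ (pbwMonomial v q κ (α, 1)) := by
    refine (QuantumExterior.basis v hqq).ext fun α => ?_
    rw [Module.Basis.constr_basis, QuantumExterior.basis_apply]
    exact extToSpecialization_monomial v q κ α
  rw [← h3]
  rfl

theorem specialize_conj (g : G) (x : V) :
    extToSpecialization v q κ (QuantumExterior.ι v q ((g : V ≃ₗ[K] V) x)) =
      specialize v q κ (heckeGroupHom v q κ g) *
        extToSpecialization v q κ (QuantumExterior.ι v q x) *
        specialize v q κ (heckeGroupHom v q κ g⁻¹) := by
  rw [extToSpecialization_ι, extToSpecialization_ι, ← map_mul, ← map_mul,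
    heckeGroupHom_mul_heckeι, mul_assoc, ← map_mul, mul_inv_cancel, map_one, mul_one]

theorem specialize_conj_mul (g : G) (x y : V) :
    extToSpecialization v q κ (QuantumExterior.ι v q ((g : V ≃ₗ[K] V) x) *
        QuantumExterior.ι v q ((g : V ≃ₗ[K] V) y)) =
      specialize v q κ (heckeGroupHom v q κ g) *
        extToSpecialization v q κ (QuantumExterior.ι v q x * QuantumExterior.ι v q y) *
        specialize v q κ (heckeGroupHom v q κ g⁻¹) := by
  have h1 : specialize v q κ (heckeGroupHom v q κ g⁻¹) * specialize v q κ (heckeGroupHom v q κ g)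
      = 1 := by
    rw [← map_mul, ← map_mul, inv_mul_cancel, map_one, map_one]
  rw [map_mul, map_mul, specialize_conj, specialize_conj]
  simp only [mul_assoc]
  rw [← mul_assoc (specialize v q κ (heckeGroupHom v q κ g⁻¹))
    (specialize v q κ (heckeGroupHom v q κ g)), h1, one_mul]

end Specialization

/-- The algebra endomorphism of `Λ_q(V)` that extends `g`. -/
def extendHom
    (hrel : ∀ (g : G) i j, i ≠ j →
      QuantumExterior.ι v q ((g : V ≃ₗ[K] V) (v j)) * QuantumExterior.ι v q ((g : V ≃ₗ[K] V) (v i))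
        = q i j • (QuantumExterior.ι v q ((g : V ≃ₗ[K] V) (v i)) *
          QuantumExterior.ι v q ((g : V ≃ₗ[K] V) (v j))))
    (hsq : ∀ (g : G) i, QuantumExterior.ι v q ((g : V ≃ₗ[K] V) (v i)) *
      QuantumExterior.ι v q ((g : V ≃ₗ[K] V) (v i)) = 0) (g : G) :
    QuantumExterior v q →ₐ[K] QuantumExterior v q :=
  QuantumExterior.lift (QuantumExterior.ι v q ∘ₗ ((g : V ≃ₗ[K] V) : V →ₗ[K] V))
    (hrel g) (hsq g)

/-- The action on `Λ_q(V)` that extends the action of `G` on `V`. -/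
def extendAction
    (hrel : ∀ (g : G) i j, i ≠ j →
      QuantumExterior.ι v q ((g : V ≃ₗ[K] V) (v j)) * QuantumExterior.ι v q ((g : V ≃ₗ[K] V) (v i))
        = q i j • (QuantumExterior.ι v q ((g : V ≃ₗ[K] V) (v i)) *
          QuantumExterior.ι v q ((g : V ≃ₗ[K] V) (v j))))
    (hsq : ∀ (g : G) i, QuantumExterior.ι v q ((g : V ≃ₗ[K] V) (v i)) *
      QuantumExterior.ι v q ((g : V ≃ₗ[K] V) (v i)) = 0) :
    G →* (QuantumExterior v q ≃ₐ[K] QuantumExterior v q) where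
  toFun g := AlgEquiv.ofAlgHom (extendHom hrel hsq g) (extendHom hrel hsq g⁻¹)
    (QuantumExterior.algHom_ext fun x => by simp [extendHom, QuantumExterior.lift_ι])
    (QuantumExterior.algHom_ext fun x => by simp [extendHom, QuantumExterior.lift_ι])
  map_one' := by
    apply AlgEquiv.coe_toAlgHom_injective
    exact QuantumExterior.algHom_ext fun x => by simp [extendHom, QuantumExterior.lift_ι]
  map_mul' g h := by
    apply AlgEquiv.coe_toAlgHom_injective
    exact QuantumExterior.algHom_ext fun x => by simp [extendHom, QuantumExterior.lift_ι]

/-- In `Ĥ / tĤ` the element `g` acts on `V` as conjugation by a unit, which preserves the relations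
of `Λ_q(V)`. Injectivity of `extToSpecialization` pulls them back to `Λ_q(V)`. -/
theorem IsTruncatedQDH.exists_extendsAction {κ : V →ₗ[K] V →ₗ[K] MonoidAlgebra K G}
    (h : IsTruncatedQDH v q κ) :
    ∃ ρ : G →* (QuantumExterior v q ≃ₐ[K] QuantumExterior v q), ExtendsAction ρ := by
  refine ⟨extendAction (fun g i j hij => ?_) (fun g i => ?_), fun g x =>
    QuantumExterior.lift_ι _ _ _ _ _ x⟩
  · apply h.extToSpecialization_injective
    rw [map_smul, specialize_conj_mul, specialize_conj_mul, QuantumExterior.ι_mul_ι v q hij,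
      map_smul, mul_smul_comm, smul_mul_assoc]
  · apply h.extToSpecialization_injective
    rw [specialize_conj_mul, QuantumExterior.ι_mul_self, map_zero, mul_zero, zero_mul]

end TruncatedQDH

/-! ### Two homomorphisms out of `Ĥ`: reduction to `Λ_q(V) ⋊ G`, and the grading. -/

namespace TruncatedQDH

variable {K : Type*} [Field K] {n : ℕ} {V : Type*} [AddCommGroup V] [Module K V]
  {v : Module.Basis (Fin n) K V} {q : Fin n → Fin n → K} {G : Subgroup (V ≃ₗ[K] V)}
  {κ : V →ₗ[K] V →ₗ[K] MonoidAlgebra K G}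

theorem extGen_mul_extGen (ρ : G →* (QuantumExterior v q ≃ₐ[K] QuantumExterior v q))
    {i j : Fin n} (hij : i ≠ j) :
    extGen ρ j * extGen ρ i = q i j • (extGen ρ i * extGen ρ j) := by
  change SkewGroupAlgebra.ofBase ρ _ * SkewGroupAlgebra.ofBase ρ _ =
    q i j • (SkewGroupAlgebra.ofBase ρ _ * SkewGroupAlgebra.ofBase ρ _)
  rw [← map_mul (SkewGroupAlgebra.ofBase ρ), ← map_mul (SkewGroupAlgebra.ofBase ρ),
    QuantumExterior.ι_mul_ι v q hij, map_smul]

theorem extGen_mul_self (ρ : G →* (QuantumExterior v q ≃ₐ[K] QuantumExterior v q)) (i : Fin n) :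
    extGen ρ i * extGen ρ i = 0 := by
  change SkewGroupAlgebra.ofBase ρ _ * SkewGroupAlgebra.ofBase ρ _ = 0
  rw [← map_mul, QuantumExterior.ι_mul_self, map_zero]

theorem skewBasis_eq_prod (ρ : G →* (QuantumExterior v q ≃ₐ[K] QuantumExterior v q))
    (hqq : ∀ i j, i ≠ j → q i j * q j i = 1) (k : (Fin n → Fin 2) × G) :
    skewBasis ρ hqq k =
      (List.ofFn fun i => extGen ρ i ^ (k.1 i : ℕ)).prod * SkewGroupAlgebra.ofGroup ρ k.2 := by
  rw [skewBasis_apply, SkewGroupAlgebra.mon_eq_mul, QuantumExterior.monomial, map_list_prod,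
    List.map_ofFn]
  simp only [Function.comp_def, map_pow]
  rfl

/-- The linear map `V → Λ_q(V) ⋊ G`. -/
def skewι (ρ : G →* (QuantumExterior v q ≃ₐ[K] QuantumExterior v q)) :
    V →ₗ[K] SkewGroupAlgebra ρ :=
  (SkewGroupAlgebra.ofBase ρ).toLinearMap ∘ₗ QuantumExterior.ι v q

theorem skewι_basis (ρ : G →* (QuantumExterior v q ≃ₐ[K] QuantumExterior v q)) (i : Fin n) :
    skewι ρ (v i) = extGen ρ i := rfl

theorem ofGroup_mul_skewι {ρ : G →* (QuantumExterior v q ≃ₐ[K] QuantumExterior v q)}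
    (hρ : ExtendsAction ρ) (g : G) (x : V) :
    SkewGroupAlgebra.ofGroup ρ g * skewι ρ x =
      skewι ρ ((g : V ≃ₗ[K] V) x) * SkewGroupAlgebra.ofGroup ρ g := by
  rw [skewι, LinearMap.comp_apply, LinearMap.comp_apply, ← hρ g x]
  exact SkewGroupAlgebra.ofGroup_mul_ofBase ρ g _

variable (κ) in
/-- Specialization `Ĥ_{q,κ,t} → Λ_q(V) ⋊ G` at `t = 0`. -/
def toSkew {ρ : G →* (QuantumExterior v q ≃ₐ[K] QuantumExterior v q)} (hρ : ExtendsAction ρ) :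
    HeckeAlgebra v q κ →+* SkewGroupAlgebra ρ :=
  heckeLift (skewι ρ) (SkewGroupAlgebra.ofGroup ρ) 0 (ofGroup_mul_skewι hρ)
    (fun _ => Commute.zero_right _)
    (fun i j => by
      rw [mul_zero, add_zero, skewι_basis, skewι_basis]
      rcases eq_or_ne i j with rfl | hij
      · rw [extGen_mul_self, smul_zero]
      · exact extGen_mul_extGen ρ hij)
    (fun i => by rw [skewι_basis, extGen_mul_self])

theorem toSkew_smul_pbwMonomial
    {ρ : G →* (QuantumExterior v q ≃ₐ[K] QuantumExterior v q)} (hρ : ExtendsAction ρ)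
    (hqq : ∀ i j, i ≠ j → q i j * q j i = 1) (p : K[X]) (k : (Fin n → Fin 2) × G) :
    toSkew κ hρ (p • pbwMonomial v q κ k) = p.coeff 0 • skewBasis ρ hqq k := by
  rw [toSkew, heckeLift_smul, heckeLift_pbwMonomial, skewBasis_eq_prod, Algebra.smul_def,
    coeff_zero_eq_aeval_zero, ← aeval_algebraMap_apply, map_zero]
  simp only [skewι_basis]

/-! #### The grading of the Hecke algebra -/

variable (κ) in
/-- The ring homomorphism `Ĥ_{q,κ,t} → Ĥ_{q,κ,t}[s]` with `v ↦ v s`, `g ↦ g` and `t ↦ t s ^ 2`. -/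
def heckeGrading : HeckeAlgebra v q κ →+* (HeckeAlgebra v q κ)[X] :=
  heckeLift (((Polynomial.monomial 1).restrictScalars K) ∘ₗ heckeι v q κ)
    (((C : HeckeAlgebra v q κ →+* (HeckeAlgebra v q κ)[X]) : HeckeAlgebra v q κ →*
      (HeckeAlgebra v q κ)[X]).comp (heckeGroupHom v q κ))
    (Polynomial.monomial 2 (algebraMap K[X] (HeckeAlgebra v q κ) X))
    (fun g x => by
      change C (heckeGroupHom v q κ g) * Polynomial.monomial 1 (heckeι v q κ x) =
        Polynomial.monomial 1 (heckeι v q κ _) * C (heckeGroupHom v q κ g)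
      rw [C_mul_monomial, monomial_mul_C, heckeGroupHom_mul_heckeι])
    (fun b => by
      induction b using Polynomial.induction_on' with
      | add a b ha hb => exact ha.add_left hb
      | monomial m a =>
        rw [Commute, SemiconjBy, monomial_mul_monomial, monomial_mul_monomial, add_comm m,
          Algebra.commutes])
    (fun i j => by
      have h : MonoidAlgebra.lift K (HeckeAlgebra v q κ)[X] G
          (((C : HeckeAlgebra v q κ →+* (HeckeAlgebra v q κ)[X]) : HeckeAlgebra v q κ →*
            (HeckeAlgebra v q κ)[X]).comp (heckeGroupHom v q κ)) =
          (CAlgHom : HeckeAlgebra v q κ →ₐ[K] (HeckeAlgebra v q κ)[X]).comp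
            (MonoidAlgebra.lift K (HeckeAlgebra v q κ) G (heckeGroupHom v q κ)) := by
        ext g
        simp
      rw [h]
      change Polynomial.monomial 1 (heckeGen v q κ j) * Polynomial.monomial 1 (heckeGen v q κ i) =
        q i j • (Polynomial.monomial 1 (heckeGen v q κ i) *
          Polynomial.monomial 1 (heckeGen v q κ j)) + C _ * _
      rw [C_mul_monomial, monomial_mul_monomial, monomial_mul_monomial, smul_monomial, ← map_add,
        heckeGen_mul_heckeGen, Algebra.smul_def X, Algebra.commutes]
      rfl)
    (fun i => by
      change Polynomial.monomial 1 (heckeGen v q κ i) * Polynomial.monomial 1 (heckeGen v q κ i) = 0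
      rw [monomial_mul_monomial, heckeGen_mul_self, map_zero])

theorem heckeGrading_pbwMonomial (k : (Fin n → Fin 2) × G) :
    heckeGrading κ (pbwMonomial v q κ k) =
      Polynomial.monomial (monomialDegree k.1) (pbwMonomial v q κ k) := by
  rw [heckeGrading, heckeLift_pbwMonomial, pbwMonomial]
  change (List.ofFn fun i => Polynomial.monomial 1 (heckeGen v q κ i) ^ (k.1 i : ℕ)).prod *
    C (heckeGroup v q κ k.2) = _
  rw [← monomial_mul_C]
  congr 1
  rw [monomialDegree, ← List.sum_ofFn, List.ofFn_eq_map, List.ofFn_eq_map, List.ofFn_eq_map]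
  induction List.finRange n with
  | nil => rfl
  | cons a l ih =>
    rw [List.map_cons, List.map_cons, List.map_cons, List.prod_cons, List.prod_cons,
      List.sum_cons, ih, monomial_pow, monomial_mul_monomial, one_mul]

theorem heckeGrading_monomial_smul (m : ℕ) (c : K) (k : (Fin n → Fin 2) × G) :
    heckeGrading κ (Polynomial.monomial m c • pbwMonomial v q κ k) =
      Polynomial.monomial (2 * m + monomialDegree k.1)
        (Polynomial.monomial m c • pbwMonomial v q κ k) := by
  have h := heckeGrading_pbwMonomial (v := v) (q := q) (κ := κ) k
  rw [heckeGrading] at h ⊢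
  rw [heckeLift_smul, h, aeval_monomial, monomial_pow, ← map_pow, Polynomial.algebraMap_apply,
    HeckeAlgebra.algebraMap_base, C_mul_monomial, ← map_mul, C_mul_X_pow_eq_monomial,
    monomial_mul_monomial, ← Algebra.smul_def]

/-! ### The deformation transported through the PBW basis. -/

namespace IsTruncatedQDH

variable (h : IsTruncatedQDH v q κ)
include h

/-- `t^m v^α g` is homogeneous of degree `2m + |α|`, so its coefficient in `x` can be read off from
that single power of `s`. -/
theorem repr_coeff_heckeGrading (x : HeckeAlgebra v q κ) (k : (Fin n → Fin 2) × G) (m : ℕ) :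
    (h.basis.repr ((heckeGrading κ x).coeff (2 * m + monomialDegree k.1)) k).coeff m =
      (h.basis.repr x k).coeff m := by
  induction x using h.basis.polynomial_induction with
  | zero => simp
  | add x y hx hy => simp only [map_add, coeff_add, Finsupp.add_apply, hx, hy]
  | monomial_smul l m' c =>
    classical
    rw [h.basis_apply, heckeGrading_monomial_smul, coeff_monomial]
    split_ifs with hd
    · rfl
    · rw [map_zero, ← h.basis_apply, map_smul, Module.Basis.repr_self, Finsupp.smul_apply,
        Finsupp.single_apply]
      split_ifs with hl
      · subst hl
        rw [smul_eq_mul, mul_one, coeff_monomial, if_neg]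
        · rfl
        · rintro rfl
          exact hd rfl
      · simp

attribute [local instance] Polynomial.algebra

variable (ρ : G →* (QuantumExterior v q ≃ₐ[K] QuantumExterior v q))

/-- The `K[t]`-linear isomorphism `Ĥ_{q,κ,t} ≃ (Λ_q(V) ⋊ G)[t]` given by the PBW basis. -/
def equivSkew : HeckeAlgebra v q κ ≃ₗ[K[X]] (SkewGroupAlgebra ρ)[X] :=
  h.basis.equiv (polynomialBasis (skewBasis ρ fun _ _ => h.mul_eq_one)) (Equiv.refl _)

theorem equivSkew_pbwMonomial (k : (Fin n → Fin 2) × G) :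
    h.equivSkew ρ (pbwMonomial v q κ k) = C (skewBasis ρ (fun _ _ => h.mul_eq_one) k) := by
  rw [← h.basis_apply, equivSkew, Module.Basis.equiv_apply, polynomialBasis_apply]
  rfl

theorem repr_coeff_equivSkew (x : HeckeAlgebra v q κ) (k : (Fin n → Fin 2) × G) (m : ℕ) :
    (skewBasis ρ fun _ _ => h.mul_eq_one).repr ((h.equivSkew ρ x).coeff m) k =
      (h.basis.repr x k).coeff m := by
  rw [repr_coeff_eq_coeff_repr, equivSkew]
  simp [Module.Basis.equiv]

variable {ρ}

/-- The right-hand side is a ring homomorphism, which is why the transported product agrees modulo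
`t` with that of `Λ_q(V) ⋊ G`. -/
theorem coeff_zero_equivSkew (hρ : ExtendsAction ρ) (x : HeckeAlgebra v q κ) :
    (h.equivSkew ρ x).coeff 0 = toSkew κ hρ x := by
  induction x using h.basis.polynomial_induction with
  | zero => simp
  | add x y hx hy => simp only [map_add, coeff_add, hx, hy]
  | monomial_smul l m c =>
    rw [h.basis_apply, toSkew_smul_pbwMonomial hρ fun _ _ => h.mul_eq_one, map_smul,
      equivSkew_pbwMonomial, coeff_smul_C]

/-- The deformation of `Λ_q(V) ⋊ G` given by a truncated quantum Drinfeld Hecke algebra. -/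
def deformation (hρ : ExtendsAction ρ) : Deformation K (SkewGroupAlgebra ρ) where
  star := LinearMap.mk₂ K[X]
    (fun x y => h.equivSkew ρ ((h.equivSkew ρ).symm x * (h.equivSkew ρ).symm y))
    (fun x y z => by rw [map_add, add_mul, map_add])
    (fun c x y => by rw [map_smul, smul_mul_assoc, map_smul])
    (fun x y z => by rw [map_add, mul_add, map_add])
    (fun c x y => by rw [map_smul, mul_smul_comm, map_smul])
  star_assoc x y z := by
    simp only [LinearMap.mk₂_apply, LinearEquiv.symm_apply_apply, mul_assoc]
  coeff_zero_star a b := by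
    rw [LinearMap.mk₂_apply, h.coeff_zero_equivSkew hρ, map_mul, ← h.coeff_zero_equivSkew hρ,
      ← h.coeff_zero_equivSkew hρ, LinearEquiv.apply_symm_apply, LinearEquiv.apply_symm_apply,
      coeff_C_zero, coeff_C_zero]

theorem deformation_star (hρ : ExtendsAction ρ) (x y : (SkewGroupAlgebra ρ)[X]) :
    (h.deformation hρ).star x y =
      h.equivSkew ρ ((h.equivSkew ρ).symm x * (h.equivSkew ρ).symm y) := rfl

theorem heckeGrading_equivSkew_symm {p : ℕ} {a : SkewGroupAlgebra ρ} (ha : a ∈ skewDegree ρ p) :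
    heckeGrading κ ((h.equivSkew ρ).symm (C a)) =
      Polynomial.monomial p ((h.equivSkew ρ).symm (C a)) := by
  have hqq : ∀ i j, i ≠ j → q i j * q j i = 1 := fun _ _ => h.mul_eq_one
  rw [mem_skewDegree_iff ρ hqq] at ha
  have hk : ∀ k, (h.equivSkew ρ).symm (C (skewBasis ρ hqq k)) = pbwMonomial v q κ k := fun k => by
    rw [LinearEquiv.symm_apply_eq, equivSkew_pbwMonomial]
  rw [← (skewBasis ρ hqq).linearCombination_repr a, Finsupp.linearCombination_apply, Finsupp.sum,
    map_sum, map_sum, map_sum, map_sum]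
  refine Finset.sum_congr rfl fun k hks => ?_
  have hd := heckeGrading_monomial_smul (v := v) (q := q) (κ := κ) 0 ((skewBasis ρ hqq).repr a k) k
  rw [mul_zero, zero_add, monomial_zero_left, Nat.cast_injective
    (ha k (Finsupp.mem_support_iff.1 hks))] at hd
  rw [Deformation.C_smul_eq, map_smul, hk, hd]

theorem isHomogeneousBilinear_deformation (hρ : ExtendsAction ρ) (m : ℕ) :
    IsHomogeneousBilinear (skewDegree ρ) ((h.deformation hρ).μ m) (-2 * (m : ℤ)) := by
  have hqq : ∀ i j, i ≠ j → q i j * q j i = 1 := fun _ _ => h.mul_eq_one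
  have hneg : ∀ d : ℤ, d < 0 → ∀ a ∈ skewDegree ρ d, a = 0 := by
    intro d hd a ha
    rw [mem_skewDegree_iff ρ hqq] at ha
    rw [← map_eq_zero_iff _ (skewBasis ρ hqq).repr.injective]
    ext k
    by_contra hne
    have := ha k hne
    omega
  intro p r a b ha hb
  -- Exponents of `s` are natural numbers; components of negative degree are zero and are disposed
  -- of first.
  rcases lt_or_ge p 0 with hp | hp
  · rw [hneg p hp a ha, map_zero, LinearMap.zero_apply]
    exact zero_mem _
  rcases lt_or_ge r 0 with hr | hr
  · rw [hneg r hr b hb, map_zero]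
    exact zero_mem _
  lift p to ℕ using hp
  lift r to ℕ using hr
  rw [mem_skewDegree_iff ρ hqq]
  intro k hk
  -- The product of the lifts of `a` and `b` lives in the single `s`-degree `p + r`, while the
  -- coefficient of `t^m` at `α` is read in `s`-degree `2m + |α|`; if it is nonzero, the two
  -- coincide.
  rw [Deformation.μ_apply, deformation_star, repr_coeff_equivSkew, ← h.repr_coeff_heckeGrading,
    map_mul, h.heckeGrading_equivSkew_symm ha, h.heckeGrading_equivSkew_symm hb,
    monomial_mul_monomial, coeff_monomial] at hk
  split_ifs at hk with hd
  · omega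
  · simp at hk

theorem exists_deformation :
    ∃ ρ : G →* (QuantumExterior v q ≃ₐ[K] QuantumExterior v q), ExtendsAction ρ ∧
      ∃ D : Deformation K (SkewGroupAlgebra ρ),
        (∀ i : ℕ, 0 < i → IsHomogeneousBilinear (skewDegree ρ) (D.μ i) (-2 * (i : ℤ))) ∧
        (∀ i : ℕ, 0 < i → ∀ j : Fin n, D.μ i (extGen ρ j) (extGen ρ j) = 0) ∧
        IsoDeformation κ D := by
  obtain ⟨ρ, hρ⟩ := h.exists_extendsAction
  have hgen : ∀ i, h.equivSkew ρ (heckeGen v q κ i) = C (extGen ρ i) := fun i => by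
    rw [heckeGen_eq_pbwMonomial, equivSkew_pbwMonomial, ← extGen_eq_skewBasis]
  refine ⟨ρ, hρ, h.deformation hρ, fun i _ => h.isHomogeneousBilinear_deformation hρ i,
    fun i _ j => ?_, h.equivSkew ρ, fun x y => ?_, hgen, fun g => ?_⟩
  · rw [Deformation.μ_apply, deformation_star, ← hgen, LinearEquiv.symm_apply_apply,
      heckeGen_mul_self, map_zero, coeff_zero]
  · rw [deformation_star, LinearEquiv.symm_apply_apply, LinearEquiv.symm_apply_apply]
  · rw [heckeGroup_eq_pbwMonomial, equivSkew_pbwMonomial, ← ofGroup_eq_skewBasis]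

end IsTruncatedQDH

end TruncatedQDH

attribute [local instance] Polynomial.algebra

/-! ### The unit and the ring structure of a deformation. -/

section Deformation

variable {K : Type*} [Field K] {A : Type*} [Ring A] [Algebra K A]

theorem X_pow_smul_C (a : A) (m : ℕ) :
    ((X : K[X]) ^ m) • (C a : A[X]) = Polynomial.monomial m a := by
  rw [← monomial_one_right_eq_X_pow, monomial_one_smul_C]

theorem X_pow_smul (f : A[X]) (m : ℕ) : ((X : K[X]) ^ m) • f = X ^ m * f := by
  rw [Algebra.smul_def, Polynomial.algebraMap_def, coe_mapRingHom, Polynomial.map_pow, map_X]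

variable (K) in
theorem eq_sum_X_pow_smul_C (f : A[X]) :
    f = ∑ m ∈ f.support, ((X : K[X]) ^ m) • (C (f.coeff m) : A[X]) := by
  conv_lhs => rw [f.as_sum_support]
  simp only [X_pow_smul_C]

namespace Deformation

variable (D : Deformation K A)

theorem coeff_zero_star_eq (f g : A[X]) : (D.star f g).coeff 0 = f.coeff 0 * g.coeff 0 := by
  have h : ∀ (f : A[X]) m, (((X : K[X]) ^ m) • f).coeff 0 = if m = 0 then f.coeff 0 else 0 := by
    intro f m
    rw [X_pow_smul]
    rcases m with _ | m
    · simp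
    · simp [pow_succ, mul_assoc]
  induction f using Polynomial.induction_on' with
  | add f₁ f₂ h₁ h₂ => rw [map_add, LinearMap.add_apply, coeff_add, h₁, h₂, coeff_add, add_mul]
  | monomial m a =>
    induction g using Polynomial.induction_on' with
    | add g₁ g₂ h₁ h₂ => rw [map_add, coeff_add, h₁, h₂, coeff_add, mul_add]
    | monomial l b =>
      rw [← X_pow_smul_C (K := K), ← X_pow_smul_C (K := K), map_smul, map_smul,
        LinearMap.smul_apply, h, h, h, h, D.coeff_zero_star, coeff_C_zero, coeff_C_zero]
      split_ifs <;> simp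

/-- A map that is the identity modulo `t` is injective: an element of the kernel is divisible by
`t`, its quotient by `t` is again in the kernel, and so all coefficients vanish in turn. -/
theorem eq_zero_of_star_eq_zero (f : A[X] →ₗ[K[X]] A[X])
    (hf : ∀ x, (f x).coeff 0 = x.coeff 0) {x : A[X]} (hx : f x = 0) : x = 0 := by
  have key : ∀ m, ∀ x : A[X], f x = 0 → x.coeff m = 0 := by
    intro m
    induction m with
    | zero => intro x hx; rw [← hf, hx, coeff_zero]
    | succ m ih =>
      intro x hx
      have h0 : x.coeff 0 = 0 := by rw [← hf, hx, coeff_zero]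
      have h1 : ((X : K[X]) ^ 1) • x.divX = x := by
        conv_rhs => rw [← X_mul_divX_add x]
        rw [X_pow_smul, h0, map_zero, add_zero, pow_one]
      rw [← coeff_divX]
      refine ih _ ?_
      rw [← h1, map_smul, X_pow_smul, pow_one] at hx
      ext i
      have := congrArg (fun y : A[X] => y.coeff (i + 1)) hx
      simpa only [coeff_X_mul, coeff_zero] using this
  ext m
  exact key m x hx

variable {D}

/-- Idempotency gives `1 * (1 * x - x) = 0`, and left multiplication by `1` is injective since it is
the identity modulo `t`. -/
theorem one_star (h1 : D.star (C 1) (C 1) = C 1) (x : A[X]) : D.star (C 1) x = x := by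
  refine sub_eq_zero.1 (eq_zero_of_star_eq_zero (D.star (C 1)) (fun y => ?_) ?_)
  · rw [coeff_zero_star_eq, coeff_C_zero, one_mul]
  · rw [map_sub, ← D.star_assoc, h1, sub_self]

theorem star_one (h1 : D.star (C 1) (C 1) = C 1) (x : A[X]) : D.star x (C 1) = x := by
  refine sub_eq_zero.1 (eq_zero_of_star_eq_zero (D.star.flip (C 1)) (fun y => ?_) ?_)
  · rw [LinearMap.flip_apply, coeff_zero_star_eq, coeff_C_zero, mul_one]
  · rw [LinearMap.flip_apply, map_sub, LinearMap.sub_apply, D.star_assoc, h1, sub_self]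

end Deformation

/-- The algebra `A[t]` with the product of the deformation `D`, when `1` is idempotent, which
makes it the unit. -/
@[nolint unusedArguments]
def DeformedAlgebra (D : Deformation K A) (_h1 : D.star (C 1) (C 1) = C 1) : Type _ := A[X]

namespace DeformedAlgebra

variable {D : Deformation K A} (h1 : D.star (C 1) (C 1) = C 1)

instance instAddCommGroup : AddCommGroup (DeformedAlgebra D h1) :=
  inferInstanceAs (AddCommGroup A[X])

instance instModule : Module K[X] (DeformedAlgebra D h1) :=
  inferInstanceAs (Module K[X] A[X])

/-- The identity map from `A[t]` to the deformed algebra. -/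
def of : A[X] ≃ₗ[K[X]] DeformedAlgebra D h1 := LinearEquiv.refl K[X] A[X]

instance instRing : Ring (DeformedAlgebra D h1) where
  __ := instAddCommGroup h1
  mul x y := of h1 (D.star ((of h1).symm x) ((of h1).symm y))
  one := of h1 (C 1)
  mul_assoc x y z := D.star_assoc x y z
  one_mul x := D.one_star h1 x
  mul_one x := D.star_one h1 x
  zero_mul x := LinearMap.map_zero₂ D.star x
  mul_zero x := (D.star x).map_zero
  left_distrib x y z := (D.star x).map_add y z
  right_distrib x y z := LinearMap.map_add₂ D.star x y z

theorem mul_def (x y : A[X]) : of h1 x * of h1 y = of h1 (D.star x y) := rfl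

instance instAlgebra : Algebra K[X] (DeformedAlgebra D h1) :=
  Algebra.ofModule (fun c x y => LinearMap.map_smul₂ D.star c x y)
    (fun c x y => (D.star x).map_smul c y)

instance instAlgebraBase : Algebra K (DeformedAlgebra D h1) :=
  Algebra.compHom _ (C : K →+* K[X])

instance instIsScalarTower : IsScalarTower K K[X] (DeformedAlgebra D h1) :=
  IsScalarTower.of_algebraMap_eq fun _ => rfl

theorem smul_base (c : K) (x : DeformedAlgebra D h1) : c • x = (C c : K[X]) • x := rfl

/-- The inclusion of `A` into the deformed algebra. -/
def ofBase : A →ₗ[K] DeformedAlgebra D h1 where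
  toFun a := of h1 (C a)
  map_add' a b := by rw [map_add, map_add]
  map_smul' c a := by rw [Deformation.C_smul_eq, map_smul, RingHom.id_apply, smul_base]

theorem ofBase_apply (a : A) : ofBase h1 a = of h1 (C a) := rfl

/-- Reduction of the deformed algebra modulo `t`. -/
def reduce : DeformedAlgebra D h1 →+* A where
  toFun x := ((of h1).symm x).coeff 0
  map_one' := coeff_C_zero
  map_mul' x y := D.coeff_zero_star_eq x y
  map_zero' := coeff_zero 0
  map_add' x y := coeff_add x y 0

theorem reduce_of (x : A[X]) : reduce h1 (of h1 x) = x.coeff 0 := rfl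

end DeformedAlgebra

end Deformation

/-! ### Degrees in a graded deformation, and the choice of `κ`. -/

namespace TruncatedQDH

variable {K : Type*} [Field K] {n : ℕ} {V : Type*} [AddCommGroup V] [Module K V]
  {v : Module.Basis (Fin n) K V} {q : Fin n → Fin n → K} {G : Subgroup (V ≃ₗ[K] V)}
  {ρ : G →* (QuantumExterior v q ≃ₐ[K] QuantumExterior v q)}

theorem mem_pow_of_extendsAction (hρ : ExtendsAction ρ) (g : G) {p : ℕ} {a : QuantumExterior v q}
    (ha : a ∈ LinearMap.range (QuantumExterior.ι v q) ^ p) :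
    ρ g a ∈ LinearMap.range (QuantumExterior.ι v q) ^ p := by
  have h := Submodule.mem_map_of_mem (f := (ρ g).toAlgHom.toLinearMap) ha
  rw [Submodule.map_pow] at h
  refine (pow_le_pow_left' ?_ p : _ ≤ LinearMap.range (QuantumExterior.ι v q) ^ p) h
  rintro _ ⟨_, ⟨x, rfl⟩, rfl⟩
  exact ⟨(g : V ≃ₗ[K] V) x, (hρ g x).symm⟩

theorem mul_mem_skewDegree (hρ : ExtendsAction ρ) {p r : ℤ} {a b : SkewGroupAlgebra ρ}
    (ha : a ∈ skewDegree ρ p) (hb : b ∈ skewDegree ρ r) : a * b ∈ skewDegree ρ (p + r) := by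
  induction ha, hb using Submodule.span_induction₂ with
  | mem_mem x y hx hy =>
    obtain ⟨p, rfl, a, ha, g, rfl⟩ := hx
    obtain ⟨r, rfl, b, hb, h, rfl⟩ := hy
    refine Submodule.subset_span ⟨p + r, by push_cast; rfl, a * ρ g b, ?_, g * h,
      SkewGroupAlgebra.mon_mul_mon ρ a b g h⟩
    rw [pow_add]
    exact Submodule.mul_mem_mul ha (mem_pow_of_extendsAction hρ g hb)
  | zero_left y hy => rw [zero_mul]; exact zero_mem _
  | zero_right x hx => rw [mul_zero]; exact zero_mem _
  | add_left x y z _ _ _ hx hy => rw [add_mul]; exact add_mem hx hy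
  | add_right x y z _ _ _ hx hy => rw [mul_add]; exact add_mem hx hy
  | smul_left c x y _ _ h => rw [smul_mul_assoc]; exact Submodule.smul_mem _ _ h
  | smul_right c x y _ _ h => rw [mul_smul_comm]; exact Submodule.smul_mem _ _ h

theorem extGen_mem_skewDegree (i : Fin n) : extGen ρ i ∈ skewDegree ρ 1 :=
  Submodule.subset_span ⟨1, rfl, _, by rw [pow_one]; exact LinearMap.mem_range_self _ _, 1, rfl⟩

theorem skewι_mem_skewDegree (x : V) : skewι ρ x ∈ skewDegree ρ 1 :=
  Submodule.subset_span ⟨1, rfl, _, by rw [pow_one]; exact LinearMap.mem_range_self _ x, 1, rfl⟩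

theorem ofGroup_mem_skewDegree (g : G) : SkewGroupAlgebra.ofGroup ρ g ∈ skewDegree ρ 0 :=
  Submodule.subset_span ⟨0, rfl, 1, by rw [pow_zero]; exact Submodule.one_le.1 le_rfl, g, rfl⟩

theorem one_mem_skewDegree : (1 : SkewGroupAlgebra ρ) ∈ skewDegree ρ 0 := by
  rw [← map_one (SkewGroupAlgebra.ofGroup ρ)]
  exact ofGroup_mem_skewDegree 1

theorem eq_zero_of_mem_skewDegree_neg {d : ℤ} (hd : d < 0) {a : SkewGroupAlgebra ρ}
    (ha : a ∈ skewDegree ρ d) : a = 0 := by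
  induction ha using Submodule.span_induction with
  | mem x hx =>
    obtain ⟨p, rfl, -⟩ := hx
    omega
  | zero => rfl
  | add x y _ _ hx hy => rw [hx, hy, add_zero]
  | smul c x _ hx => rw [hx, smul_zero]

/-- Words without letters lie in `KG`; this is what allows `κ` to take its values there. -/
theorem exists_ofGroupAlgebra_eq {a : SkewGroupAlgebra ρ} (ha : a ∈ skewDegree ρ 0) :
    ∃ y, SkewGroupAlgebra.ofGroupAlgebra ρ y = a := by
  induction ha using Submodule.span_induction with
  | mem x hx =>
    obtain ⟨p, hp, a, ha, g, rfl⟩ := hx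
    obtain rfl : p = 0 := by omega
    rw [pow_zero, Submodule.mem_one] at ha
    obtain ⟨c, rfl⟩ := ha
    refine ⟨c • MonoidAlgebra.of K G g, ?_⟩
    rw [map_smul, SkewGroupAlgebra.ofGroupAlgebra, MonoidAlgebra.lift_of,
      SkewGroupAlgebra.mon_eq_mul, AlgHom.commutes, Algebra.smul_def]
  | zero => exact ⟨0, map_zero _⟩
  | add x y _ _ hx hy =>
    obtain ⟨a, rfl⟩ := hx
    obtain ⟨b, rfl⟩ := hy
    exact ⟨a + b, map_add _ _ _⟩
  | smul c x _ hx =>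
    obtain ⟨a, rfl⟩ := hx
    exact ⟨c • a, map_smul _ _ _⟩

variable (ρ) in
/-- The elements of degree `d` of `(Λ_q(V) ⋊ G)[t]`, where `t` has degree `2`. -/
def gradedPart (d : ℤ) : AddSubgroup (SkewGroupAlgebra ρ)[X] where
  carrier := {f | ∀ m : ℕ, f.coeff m ∈ skewDegree ρ (d - 2 * m)}
  zero_mem' _ := by rw [coeff_zero]; exact zero_mem _
  add_mem' hf hg m := by rw [coeff_add]; exact add_mem (hf m) (hg m)
  neg_mem' hf m := by rw [coeff_neg]; exact Submodule.neg_mem _ (hf m)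

theorem C_mem_gradedPart {d : ℤ} {a : SkewGroupAlgebra ρ} (ha : a ∈ skewDegree ρ d) :
    C a ∈ gradedPart ρ d := by
  intro m
  rw [coeff_C]
  split_ifs with h
  · simpa [h] using ha
  · exact zero_mem _

theorem X_pow_smul_mem_gradedPart {d e : ℤ} {f : (SkewGroupAlgebra ρ)[X]}
    (hf : f ∈ gradedPart ρ d) (m : ℕ) (he : e = d + 2 * m) :
    ((X : K[X]) ^ m) • f ∈ gradedPart ρ e := by
  intro l
  rw [X_pow_smul, coeff_X_pow_mul']
  split_ifs with h
  · have := hf (l - m)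
    rwa [Nat.cast_sub h, show d - 2 * ((l : ℤ) - m) = e - 2 * l by rw [he]; ring] at this
  · exact zero_mem _

section

variable {D : Deformation K (SkewGroupAlgebra ρ)}
  (hD : ∀ i : ℕ, 0 < i → IsHomogeneousBilinear (skewDegree ρ) (D.μ i) (-2 * (i : ℤ)))
include hD

theorem star_C_C_mem_gradedPart (hρ : ExtendsAction ρ) {p r : ℤ} {a b : SkewGroupAlgebra ρ}
    (ha : a ∈ skewDegree ρ p) (hb : b ∈ skewDegree ρ r) :
    D.star (C a) (C b) ∈ gradedPart ρ (p + r) := by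
  intro m
  rcases Nat.eq_zero_or_pos m with rfl | hm
  · rw [D.coeff_zero_star]
    simpa using mul_mem_skewDegree hρ ha hb
  · have := hD m hm p r a b ha hb
    rwa [Deformation.μ_apply, show p + r + -2 * (m : ℤ) = p + r - 2 * m by ring] at this

theorem star_mem_gradedPart (hρ : ExtendsAction ρ) {p r : ℤ} {f g : (SkewGroupAlgebra ρ)[X]}
    (hf : f ∈ gradedPart ρ p) (hg : g ∈ gradedPart ρ r) : D.star f g ∈ gradedPart ρ (p + r) := by
  rw [eq_sum_X_pow_smul_C K f, eq_sum_X_pow_smul_C K g, map_sum]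
  refine sum_mem fun l _ => ?_
  rw [map_sum, LinearMap.sum_apply]
  refine sum_mem fun m _ => ?_
  rw [map_smul, map_smul, LinearMap.smul_apply]
  exact X_pow_smul_mem_gradedPart (X_pow_smul_mem_gradedPart
    (star_C_C_mem_gradedPart hD hρ (hf m) (hg l)) m rfl) l (by ring)

/-- For `m ≥ 2` the value of `μ m` has degree `p + r - 2m < 0`, hence is zero. -/
theorem star_C_C_eq_of_lt_four {p r : ℤ} (hpr : p + r < 4) {a b : SkewGroupAlgebra ρ}
    (ha : a ∈ skewDegree ρ p) (hb : b ∈ skewDegree ρ r) :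
    D.star (C a) (C b) = C (a * b) + (X : K[X]) • C (D.μ 1 a b) := by
  rw [← pow_one (X : K[X]), X_pow_smul_C]
  ext m
  rw [coeff_add, coeff_C, coeff_monomial]
  rcases m with _ | _ | m
  · simp [D.coeff_zero_star]
  · simp [Deformation.μ_apply]
  · have := hD (m + 2) (by omega) p r a b ha hb
    rw [Deformation.μ_apply] at this
    rw [eq_zero_of_mem_skewDegree_neg (by push_cast; omega) this]
    simp

theorem star_C_C_eq_of_lt_two {p r : ℤ} (hpr : p + r < 2) {a b : SkewGroupAlgebra ρ}
    (ha : a ∈ skewDegree ρ p) (hb : b ∈ skewDegree ρ r) :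
    D.star (C a) (C b) = C (a * b) := by
  rw [star_C_C_eq_of_lt_four hD (by omega) ha hb,
    eq_zero_of_mem_skewDegree_neg (by push_cast; omega) (hD 1 one_pos p r a b ha hb), map_zero,
    smul_zero, add_zero]

/-- Total degree `0` leaves no room for correction terms. Idempotency then makes `1` the unit, so
unitality need not be part of the definition of a deformation. -/
theorem star_one_one : D.star (C 1) (C 1) = C 1 := by
  rw [star_C_C_eq_of_lt_two hD (by norm_num) one_mem_skewDegree one_mem_skewDegree, one_mul]

/-- `κ` is forced: the right-hand side is the coefficient of `t` in `v_j * v_i - q_{ij} v_i * v_j`,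
which has degree `1 + 1 - 2 = 0`. -/
theorem exists_kappa : ∃ κ : V →ₗ[K] V →ₗ[K] MonoidAlgebra K G, ∀ i j,
    SkewGroupAlgebra.ofGroupAlgebra ρ (κ (v i) (v j)) =
      D.μ 1 (extGen ρ j) (extGen ρ i) - q i j • D.μ 1 (extGen ρ i) (extGen ρ j) := by
  have hμ : ∀ i j, D.μ 1 (extGen ρ j) (extGen ρ i) ∈ skewDegree ρ 0 := fun i j => by
    simpa using hD 1 one_pos 1 1 _ _ (extGen_mem_skewDegree j) (extGen_mem_skewDegree i)
  choose y hy using fun i j => exists_ofGroupAlgebra_eq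
    (Submodule.sub_mem _ (hμ i j) (Submodule.smul_mem _ (q i j) (hμ j i)))
  exact ⟨v.constr K fun i => v.constr K fun j => y i j, fun i j => by simp [hy]⟩

/-- The group homomorphism from `G` to the deformed algebra. -/
def deformedGroupHom : G →* DeformedAlgebra D (star_one_one hD) where
  toFun g := DeformedAlgebra.ofBase _ (SkewGroupAlgebra.ofGroup ρ g)
  map_one' := by rw [map_one]; rfl
  map_mul' g h := by
    rw [DeformedAlgebra.ofBase_apply, DeformedAlgebra.ofBase_apply, DeformedAlgebra.ofBase_apply,
      DeformedAlgebra.mul_def, star_C_C_eq_of_lt_two hD (by norm_num) (ofGroup_mem_skewDegree g)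
      (ofGroup_mem_skewDegree h), map_mul]

theorem deformedGroupHom_apply (g : G) : deformedGroupHom hD g =
    DeformedAlgebra.ofBase _ (SkewGroupAlgebra.ofGroup ρ g) := rfl

theorem lift_deformedGroupHom (y : MonoidAlgebra K G) :
    MonoidAlgebra.lift K _ G (deformedGroupHom hD) y =
      DeformedAlgebra.ofBase _ (SkewGroupAlgebra.ofGroupAlgebra ρ y) := by
  induction y using MonoidAlgebra.induction_on with
  | of g =>
    rw [MonoidAlgebra.lift_of, SkewGroupAlgebra.ofGroupAlgebra, MonoidAlgebra.lift_of]
    rfl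
  | add a b ha hb => rw [map_add, ha, hb, map_add, map_add]
  | smul c a ha => rw [map_smul, ha, map_smul, map_smul]

end

end TruncatedQDH

namespace TruncatedQDH

variable {K : Type*} [Field K] {n : ℕ} {V : Type*} [AddCommGroup V] [Module K V]
  {v : Module.Basis (Fin n) K V} {q : Fin n → Fin n → K} {G : Subgroup (V ≃ₗ[K] V)}
  {ρ : G →* (QuantumExterior v q ≃ₐ[K] QuantumExterior v q)}
  {κ : V →ₗ[K] V →ₗ[K] MonoidAlgebra K G}

/-! ### From a deformation to a PBW basis -/

section

variable (hρ : ExtendsAction ρ) {D : Deformation K (SkewGroupAlgebra ρ)}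
  (hD : ∀ i : ℕ, 0 < i → IsHomogeneousBilinear (skewDegree ρ) (D.μ i) (-2 * (i : ℤ)))
  (hD0 : ∀ i : ℕ, 0 < i → ∀ j : Fin n, D.μ i (extGen ρ j) (extGen ρ j) = 0)
  (hκ : ∀ i j, SkewGroupAlgebra.ofGroupAlgebra ρ (κ (v i) (v j)) =
    D.μ 1 (extGen ρ j) (extGen ρ i) - q i j • D.μ 1 (extGen ρ i) (extGen ρ j))

include hD in
theorem ofBase_extGen_mul (i j : Fin n) :
    DeformedAlgebra.ofBase (star_one_one hD) (extGen ρ i) *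
        DeformedAlgebra.ofBase (star_one_one hD) (extGen ρ j) =
      DeformedAlgebra.ofBase (star_one_one hD) (extGen ρ i * extGen ρ j) +
        (X : K[X]) • DeformedAlgebra.ofBase (star_one_one hD)
          (D.μ 1 (extGen ρ i) (extGen ρ j)) := by
  simp only [DeformedAlgebra.ofBase_apply]
  rw [DeformedAlgebra.mul_def, star_C_C_eq_of_lt_four hD (by norm_num) (extGen_mem_skewDegree i)
    (extGen_mem_skewDegree j), map_add, map_smul]

/-- The map from `Ĥ_{q,κ,t}` to the deformed algebra. -/
def toDeformed : HeckeAlgebra v q κ →+* DeformedAlgebra D (star_one_one hD) :=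
  heckeLift (DeformedAlgebra.ofBase (star_one_one hD) ∘ₗ skewι ρ) (deformedGroupHom hD)
    (algebraMap K[X] _ X)
    (fun g x => by
      rw [LinearMap.comp_apply, LinearMap.comp_apply, deformedGroupHom_apply,
        DeformedAlgebra.ofBase_apply, DeformedAlgebra.ofBase_apply, DeformedAlgebra.ofBase_apply,
        DeformedAlgebra.mul_def, DeformedAlgebra.mul_def,
        star_C_C_eq_of_lt_two hD (by norm_num) (ofGroup_mem_skewDegree g) (skewι_mem_skewDegree x),
        star_C_C_eq_of_lt_two hD (by norm_num) (skewι_mem_skewDegree _)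
          (ofGroup_mem_skewDegree g), ofGroup_mul_skewι hρ])
    (fun b => Algebra.commute_algebraMap_right X b)
    (fun i j => by
      -- The Hecke relation is also imposed for `i = j`, where both sides here vanish whatever `q i
      -- i` is.
      have hrel : extGen ρ j * extGen ρ i = q i j • (extGen ρ i * extGen ρ j) := by
        rcases eq_or_ne i j with rfl | hij
        · rw [extGen_mul_self, smul_zero]
        · exact extGen_mul_extGen ρ hij
      rw [LinearMap.comp_apply, LinearMap.comp_apply, skewι_basis, skewι_basis,
        ofBase_extGen_mul hD, ofBase_extGen_mul hD, lift_deformedGroupHom, hκ, hrel, map_sub,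
        map_smul, map_smul, ← Algebra.commutes, ← Algebra.smul_def, smul_sub, smul_add,
        smul_comm (X : K[X]) (q i j)]
      abel)
    -- In total degree 2 only `μ 1` can contribute, so its vanishing on `(v_i, v_i)` suffices.
    (fun i => by
      rw [LinearMap.comp_apply, skewι_basis, ofBase_extGen_mul hD, extGen_mul_self,
        hD0 1 one_pos i, map_zero, smul_zero, add_zero])

theorem toDeformed_heckeGen (i : Fin n) :
    toDeformed hρ hD hD0 hκ (heckeGen v q κ i) = DeformedAlgebra.ofBase _ (extGen ρ i) := by
  rw [toDeformed, heckeLift_heckeGen]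
  rfl

theorem toDeformed_heckeGroup (g : G) : toDeformed hρ hD hD0 hκ (heckeGroup v q κ g) =
    DeformedAlgebra.ofBase _ (SkewGroupAlgebra.ofGroup ρ g) := by
  rw [toDeformed, heckeLift_heckeGroup]
  rfl

/-- The map from `Ĥ_{q,κ,t}` to the underlying module of the deformed algebra. -/
def toDeformedLinear : HeckeAlgebra v q κ →ₗ[K[X]] (SkewGroupAlgebra ρ)[X] where
  toFun x := (DeformedAlgebra.of (star_one_one hD)).symm (toDeformed hρ hD hD0 hκ x)
  map_add' x y := by rw [map_add, map_add]
  map_smul' p x := by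
    rw [toDeformed, heckeLift_smul, aeval_algebraMap_apply, aeval_X_left_apply,
      ← Algebra.smul_def, map_smul, RingHom.id_apply]

theorem toDeformedLinear_mul (x y : HeckeAlgebra v q κ) :
    toDeformedLinear hρ hD hD0 hκ (x * y) =
      D.star (toDeformedLinear hρ hD hD0 hκ x) (toDeformedLinear hρ hD hD0 hκ y) :=
  congrArg (DeformedAlgebra.of (star_one_one hD)).symm (map_mul (toDeformed hρ hD hD0 hκ) x y)

theorem toDeformedLinear_heckeGen (i : Fin n) :
    toDeformedLinear hρ hD hD0 hκ (heckeGen v q κ i) = C (extGen ρ i) :=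
  congrArg (DeformedAlgebra.of (star_one_one hD)).symm (toDeformed_heckeGen hρ hD hD0 hκ i)

theorem toDeformedLinear_heckeGroup (g : G) :
    toDeformedLinear hρ hD hD0 hκ (heckeGroup v q κ g) = C (SkewGroupAlgebra.ofGroup ρ g) :=
  congrArg (DeformedAlgebra.of (star_one_one hD)).symm (toDeformed_heckeGroup hρ hD hD0 hκ g)

theorem coeff_zero_toDeformedLinear_pbwMonomial (hqq : ∀ i j, i ≠ j → q i j * q j i = 1)
    (k : (Fin n → Fin 2) × G) :
    (toDeformedLinear hρ hD hD0 hκ (pbwMonomial v q κ k)).coeff 0 = skewBasis ρ hqq k := by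
  change DeformedAlgebra.reduce (star_one_one hD) (toDeformed hρ hD hD0 hκ _) = _
  rw [pbwMonomial, map_mul, map_mul, toDeformed_heckeGroup, map_list_prod, map_list_prod,
    List.map_ofFn, List.map_ofFn, skewBasis_eq_prod]
  simp only [Function.comp_def, map_pow, toDeformed_heckeGen, DeformedAlgebra.ofBase_apply,
    DeformedAlgebra.reduce_of, coeff_C_zero]

theorem toDeformedLinear_one : toDeformedLinear hρ hD hD0 hκ 1 = C 1 :=
  congrArg (DeformedAlgebra.of (star_one_one hD)).symm (map_one (toDeformed hρ hD hD0 hκ))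

/-- Generators map to homogeneous elements, and the deformed product respects the grading with `t`
in degree 2. -/
theorem toDeformedLinear_pbwMonomial_mem_gradedPart (k : (Fin n → Fin 2) × G) :
    toDeformedLinear hρ hD hD0 hκ (pbwMonomial v q κ k) ∈ gradedPart ρ (monomialDegree k.1) := by
  rw [pbwMonomial, toDeformedLinear_mul, toDeformedLinear_heckeGroup,
    ← add_zero (monomialDegree k.1 : ℤ)]
  refine star_mem_gradedPart hD hρ ?_ (C_mem_gradedPart (ofGroup_mem_skewDegree _))
  rw [monomialDegree, ← List.sum_ofFn, List.ofFn_eq_map, List.ofFn_eq_map]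
  induction List.finRange n with
  | nil => exact toDeformedLinear_one hρ hD hD0 hκ ▸ C_mem_gradedPart one_mem_skewDegree
  | cons a l ih =>
    rw [List.map_cons, List.map_cons, List.prod_cons, List.sum_cons, toDeformedLinear_mul,
      Nat.cast_add]
    refine star_mem_gradedPart hD hρ ?_ ih
    rcases Fin.exists_fin_two.1 ⟨k.1 a, rfl⟩ with h | h <;> rw [h]
    · exact (pow_zero (heckeGen v q κ a)).symm ▸
        toDeformedLinear_one hρ hD hD0 hκ ▸ C_mem_gradedPart one_mem_skewDegree
    · rw [Fin.val_one, pow_one, toDeformedLinear_heckeGen]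
      exact C_mem_gradedPart (extGen_mem_skewDegree a)

/-- Triangularity: the image of a PBW monomial of degree `d` is the corresponding basis monomial
plus terms `t^m a` with `m ≥ 1` and `a` of degree `d - 2m`, to which strong induction applies. -/
theorem C_mem_range_toDeformedLinear (hqq : ∀ i j, i ≠ j → q i j * q j i = 1) (d : ℕ) :
    ∀ a ∈ skewDegree ρ d, C a ∈ LinearMap.range (toDeformedLinear hρ hD hD0 hκ) := by
  induction d using Nat.strong_induction_on with
  | _ d ih =>
  intro a ha
  rw [mem_skewDegree_iff ρ hqq] at ha
  rw [← (skewBasis ρ hqq).linearCombination_repr a, Finsupp.linearCombination_apply, Finsupp.sum,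
    map_sum]
  refine Submodule.sum_mem _ fun k hk => ?_
  rw [Deformation.C_smul_eq]
  refine Submodule.smul_mem _ _ ?_
  have hkd : monomialDegree k.1 = d := Nat.cast_injective (ha k (Finsupp.mem_support_iff.1 hk))
  have hg := toDeformedLinear_pbwMonomial_mem_gradedPart hρ hD hD0 hκ k
  have h0 := coeff_zero_toDeformedLinear_pbwMonomial hρ hD hD0 hκ hqq k
  have hmem := LinearMap.mem_range_self (toDeformedLinear hρ hD hD0 hκ) (pbwMonomial v q κ k)
  rw [hkd] at hg
  generalize toDeformedLinear hρ hD hD0 hκ (pbwMonomial v q κ k) = f at hg h0 hmem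
  have hf : f = C (skewBasis ρ hqq k) +
      ∑ m ∈ f.support.erase 0, ((X : K[X]) ^ m) • (C (f.coeff m) : (SkewGroupAlgebra ρ)[X]) := by
    by_cases hs : 0 ∈ f.support
    · conv_lhs => rw [eq_sum_X_pow_smul_C K f]
      rw [← Finset.add_sum_erase _ _ hs, pow_zero, one_smul, h0]
    · rw [Finset.erase_eq_of_notMem hs, ← eq_sum_X_pow_smul_C, ← h0,
        notMem_support_iff.1 hs, map_zero, zero_add]
  rw [← sub_eq_iff_eq_add] at hf
  rw [← hf]
  refine Submodule.sub_mem _ hmem (Submodule.sum_mem _ fun m hm => Submodule.smul_mem _ _ ?_)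
  have hm0 : m ≠ 0 := Finset.ne_of_mem_erase hm
  -- If `d < 2m` the coefficient has negative degree and vanishes; otherwise its degree `d - 2m` is
  -- smaller than `d` since `m ≠ 0`.
  rcases lt_or_ge d (2 * m) with hlt | hge
  · rw [eq_zero_of_mem_skewDegree_neg (by omega) (hg m), map_zero]
    exact zero_mem _
  · refine ih (d - 2 * m) (by omega) _ ?_
    rw [Nat.cast_sub hge]
    exact_mod_cast hg m

theorem range_toDeformedLinear (hqq : ∀ i j, i ≠ j → q i j * q j i = 1) :
    LinearMap.range (toDeformedLinear hρ hD hD0 hκ) = ⊤ := by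
  rw [eq_top_iff, ← (polynomialBasis (skewBasis ρ hqq)).span_eq, Submodule.span_le]
  rintro _ ⟨k, rfl⟩
  rw [polynomialBasis_apply]
  exact C_mem_range_toDeformedLinear hρ hD hD0 hκ hqq _ _ (skewBasis_mem_skewDegree ρ hqq k)

/-- The endomorphism sending the monomial basis to the images of the PBW monomials is onto, because
those monomials span `Ĥ` and `Ĥ` maps onto the target. The module has finite rank as `G` is finite,
so the endomorphism is injective. -/
theorem linearIndependent_toDeformedLinear [Finite G]
    (hqq : ∀ i j, i ≠ j → q i j * q j i = 1) :
    LinearIndependent K[X] fun k => toDeformedLinear hρ hD hD0 hκ (pbwMonomial v q κ k) := by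
  let b := polynomialBasis (skewBasis ρ hqq)
  let L : (SkewGroupAlgebra ρ)[X] →ₗ[K[X]] (SkewGroupAlgebra ρ)[X] :=
    b.constr K[X] fun k => toDeformedLinear hρ hD hD0 hκ (pbwMonomial v q κ k)
  have : Module.Finite K[X] (SkewGroupAlgebra ρ)[X] := Module.Finite.of_basis b
  have hL : Function.Surjective L := by
    rw [← LinearMap.range_eq_top, Module.Basis.constr_range, Set.range_comp' _ (pbwMonomial v q κ),
      ← Submodule.map_span, span_pbwMonomial, Submodule.map_top]
    exact range_toDeformedLinear hρ hD hD0 hκ hqq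
  have hinj := OrzechProperty.injective_of_surjective_endomorphism L hL
  have h := b.linearIndependent.map' L (LinearMap.ker_eq_bot.2 hinj)
  have hLb : L ∘ b = fun k => toDeformedLinear hρ hD hD0 hκ (pbwMonomial v q κ k) :=
    funext fun k => Module.Basis.constr_basis b K[X] _ k
  rwa [hLb] at h

include hρ hD hD0 hκ in
theorem isTruncatedQDH_and_isoDeformation [Finite G]
    (hqq : ∀ i j, i ≠ j → q i j * q j i = 1) :
    IsTruncatedQDH v q κ ∧ IsoDeformation κ D := by
  have hli := linearIndependent_toDeformedLinear hρ hD hD0 hκ hqq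
  have hT : IsTruncatedQDH v q κ :=
    ⟨LinearIndependent.of_comp (toDeformedLinear hρ hD hD0 hκ) hli, span_pbwMonomial v q κ⟩
  refine ⟨hT, LinearEquiv.ofBijective (toDeformedLinear hρ hD hD0 hκ) ⟨?_, ?_⟩,
    toDeformedLinear_mul hρ hD hD0 hκ, toDeformedLinear_heckeGen hρ hD hD0 hκ,
    toDeformedLinear_heckeGroup hρ hD hD0 hκ⟩
  -- The map carries the PBW basis, now available, to an independent family.
  · have h := hT.basis.injective_constr_of_linearIndependent (R₂ := K[X]) hli
    convert h using 2
    refine hT.basis.ext fun k => ?_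
    rw [Module.Basis.constr_basis, hT.basis_apply]
  · exact LinearMap.range_eq_top.1 (range_toDeformedLinear hρ hD hD0 hκ hqq)

end

end TruncatedQDH

end

theorem mainTheorem2 {K : Type*} [Field K] (hK : ringChar K ≠ 2)
    {n : ℕ} {V : Type*} [AddCommGroup V] [Module K V] (v : Module.Basis (Fin n) K V)
    (q : Fin n → Fin n → K) (hq : ∀ i j, q i j ≠ 0)
    (G : Subgroup (V ≃ₗ[K] V)) [Finite G] (hG : ¬ ringChar K ∣ Nat.card G) :
    (∀ κ : V →ₗ[K] V →ₗ[K] MonoidAlgebra K G, TruncatedQDH.IsTruncatedQDH v q κ →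
      (∀ i j, i ≠ j → q i j * q j i = 1) ∧
      ∃ ρ : G →* (TruncatedQDH.QuantumExterior v q ≃ₐ[K] TruncatedQDH.QuantumExterior v q),
        TruncatedQDH.ExtendsAction ρ ∧
        ∃ D : Deformation K (SkewGroupAlgebra ρ),
          (∀ i : ℕ, 0 < i →
            IsHomogeneousBilinear (TruncatedQDH.skewDegree ρ) (D.μ i) (-2 * (i : ℤ))) ∧
          (∀ i : ℕ, 0 < i → ∀ j : Fin n,
            D.μ i (TruncatedQDH.extGen ρ j) (TruncatedQDH.extGen ρ j) = 0) ∧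
          TruncatedQDH.IsoDeformation κ D) ∧
    ((∀ i j, i ≠ j → q i j * q j i = 1) →
      ∀ ρ : G →* (TruncatedQDH.QuantumExterior v q ≃ₐ[K] TruncatedQDH.QuantumExterior v q),
        TruncatedQDH.ExtendsAction ρ →
        ∀ D : Deformation K (SkewGroupAlgebra ρ),
          (∀ i : ℕ, 0 < i →
            IsHomogeneousBilinear (TruncatedQDH.skewDegree ρ) (D.μ i) (-2 * (i : ℤ))) →
          (∀ i : ℕ, 0 < i → ∀ j : Fin n,
            D.μ i (TruncatedQDH.extGen ρ j) (TruncatedQDH.extGen ρ j) = 0) →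
          ∃ κ : V →ₗ[K] V →ₗ[K] MonoidAlgebra K G,
            TruncatedQDH.IsTruncatedQDH v q κ ∧ TruncatedQDH.IsoDeformation κ D) := by
  refine ⟨fun κ h => ⟨fun _ _ => h.mul_eq_one, h.exists_deformation⟩, ?_⟩
  intro hqq ρ hρ D hD hD0
  obtain ⟨κ, hκ⟩ := TruncatedQDH.exists_kappa hD
  exact ⟨κ, TruncatedQDH.isTruncatedQDH_and_isoDeformation hρ hD hD0 hκ hqq⟩
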